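/- Let $M$ be a connected (Hausdorff) smooth manifold of dimension $m$ with a smooth Riemannian metric $g$, let $\Sigma\subset TM$ be a smooth distribution of rank $k$, and let $g_c=g|_\Sigma$; thus $(M,\Sigma,g_c)$ is a sub-Riemannian manifold with the orthogonal decomposition $TM=\Sigma\oplus\Sigma^\perp$. Let $\nabla$ be the Levi-Civita connection of $g$, let $\mathcal P:TM\to\Sigma$ be the $g$-orthogonal projection, and let $D_XY=\mathcal P(\nabla_XY)$, for smooth sections $X,Y$ of $\Sigma$, be the horizontal connection. A nonholonomic geodesic is a smooth curve $\gamma:[a,b]\to M$ with $\dot\gamma\in\Sigma_\gamma$ and $D_{\dot\gamma}\dot\gamma=0$. A broken geodesic is a continuous curve $\gamma:[a,b]\to M$, $a<b$, for which there is a finite subdivision of $[a,b]$ such that $\gamma$ is a nonholonomic geodesic on each closed subinterval; its length is $\int_a^b\sqrt{g_c(\dot\gamma,\dot\gamma)}\,dt$. Suppose that $\Sigma$ is bracket generating: for every $p\in M$ there is an integer $l$ such that $T_pM$ is spanned by the values at $p$ of the iterated Lie brackets of order at most $l$ of smooth sections of $\Sigma$ (a section itself having order $1$). Then for any two points $p,q\in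 M$ there is a broken geodesic from $p$ to $q$. Consequently $$d_{\mathcal H}(p,q)=\inf\{\text{length of }\gamma:\ \gamma\text{ a broken geodesic from }p\text{ to }q\}$$ is a well-defined distance on $M$: it is finite, $d_{\mathcal H}(p,q)=0$ if and only if $p=q$, $d_{\mathcal H}(p,q)=d_{\mathcal H}(q,p)$, and $d_{\mathcal H}(p,r)\le d_{\mathcal H}(p,q)+d_{\mathcal H}(q,r)$ for all $p,q,r\in M$. -/

import Mathlib

open Set Bundle Manifold
open scoped ContDiff ENNReal

noncomputable section

namespace SubRiem

section Basic

variable {m : ℕ} {M : Type*} [TopologicalSpace M] [ChartedSpace (EuclideanSpace ℝ (Fin m)) M]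

/-- A (not necessarily continuous) vector field on the `m`-dimensional manifold `M`. -/
abbrev VField (m : ℕ) (M : Type*) [TopologicalSpace M]
    [ChartedSpace (EuclideanSpace ℝ (Fin m)) M] : Type _ :=
  (x : M) → TangentSpace (𝓡 m) x

variable [IsManifold (𝓡 m) ∞ M]

/-- The vector field `X` is smooth (`C^∞`) on the set `U`. -/
def SmoothFieldOn (X : VField m M) (U : Set M) : Prop :=
  ContMDiffOn (𝓡 m) (𝓡 m).tangent ∞ (fun x => (⟨x, X x⟩ : TangentBundle (𝓡 m) M)) U

/-- A smooth distribution of rank `k` on `M`: a `k`-dimensional subspace of each tangent space,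
spanned near each point by smooth vector fields. -/
structure Distribution (m k : ℕ) (M : Type*) [TopologicalSpace M]
    [ChartedSpace (EuclideanSpace ℝ (Fin m)) M] [IsManifold (𝓡 m) ∞ M] where
  /-- The horizontal subspace at a point. -/
  at' : (x : M) → Submodule ℝ (TangentSpace (𝓡 m) x)
  finrank_eq : ∀ x, Module.finrank ℝ (at' x) = k
  exists_frame : ∀ x : M, ∃ U : Set M, IsOpen U ∧ x ∈ U ∧ ∃ X : Fin k → VField m M,
    (∀ i, SmoothFieldOn (X i) U) ∧ ∀ y ∈ U, Submodule.span ℝ (range fun i => X i y) = at' y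

variable {k : ℕ} (S : Distribution m k M)

namespace Distribution

/-- The smooth global sections of the distribution. -/
def IsSection (X : VField m M) : Prop :=
  SmoothFieldOn X univ ∧ ∀ x, X x ∈ S.at' x

/-- `S.IsCommutator i X`: `X` is an iterated Lie bracket (with any bracketing) of `i` smooth
sections of the distribution; a commutator of order `1` is a section. -/
inductive IsCommutator : ℕ → VField m M → Prop
  | of {X : VField m M} (hX : S.IsSection X) : IsCommutator 1 X
  | bracket {i j : ℕ} {X Y : VField m M} (hX : IsCommutator i X) (hY : IsCommutator j Y) :
      IsCommutator (i + j) (VectorField.mlieBracket (𝓡 m) X Y)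

/-- The subspace of the tangent space at `p` spanned by the values at `p` of the commutators of
order at most `l` of sections of the distribution. -/
def derivedAt (l : ℕ) (p : M) : Submodule ℝ (TangentSpace (𝓡 m) p) :=
  Submodule.span ℝ {v | ∃ i ≤ l, ∃ X : VField m M, S.IsCommutator i X ∧ X p = v}

/-- The Chow (Hörmander) condition. -/
def IsBracketGenerating : Prop :=
  ∀ p : M, ∃ l : ℕ, S.derivedAt l p = ⊤

end Distribution

end Basic

section Metric

variable {m : ℕ} {M : Type*} [TopologicalSpace M] [ChartedSpace (EuclideanSpace ℝ (Fin m)) M]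
  [IsManifold (𝓡 m) ∞ M] [RiemannianBundle (fun x : M => TangentSpace (𝓡 m) x)]

instance finiteDimensional_tangentSpace (x : M) : FiniteDimensional ℝ (TangentSpace (𝓡 m) x) :=
  inferInstanceAs (FiniteDimensional ℝ (EuclideanSpace ℝ (Fin m)))

/-- The right-hand side of the Koszul formula, which equals `g(∇_X Y, Z)` at `x`. -/
def koszul (X Y Z : VField m M) (x : M) : ℝ :=
  (1 / 2 : ℝ) *
    (mvfderiv (𝓡 m) (fun y => inner ℝ (Y y) (Z y)) x (X x)
      + mvfderiv (𝓡 m) (fun y => inner ℝ (X y) (Z y)) x (Y x)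
      - mvfderiv (𝓡 m) (fun y => inner ℝ (X y) (Y y)) x (Z x)
      + inner ℝ (VectorField.mlieBracket (𝓡 m) X Y x) (Z x)
      - inner ℝ (VectorField.mlieBracket (𝓡 m) X Z x) (Y x)
      - inner ℝ (VectorField.mlieBracket (𝓡 m) Y Z x) (X x))

/-- The Levi-Civita connection `∇_X Y` of the Riemannian metric at `x`, through the Koszul formula:
its components in an orthonormal basis of the tangent space at `x` are obtained by extending the
basis vectors to vector fields that are smooth near `x` (the choice of the extensions is
irrelevant when `X` and `Y` are differentiable at `x`). -/
def leviCivita (X Y : VField m M) (x : M) : TangentSpace (𝓡 m) x :=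
  ∑ a, koszul X Y (FiberBundle.extend (EuclideanSpace ℝ (Fin m))
      (stdOrthonormalBasis ℝ (TangentSpace (𝓡 m) x) a)) x •
    stdOrthonormalBasis ℝ (TangentSpace (𝓡 m) x) a

/-- The velocity vector of a curve. -/
def velocity (γ : ℝ → M) (t : ℝ) : TangentSpace (𝓡 m) (γ t) :=
  mfderiv 𝓘(ℝ, ℝ) (𝓡 m) γ t (1 : ℝ)

namespace Distribution

variable {k : ℕ} (S : Distribution m k M)

/-- The horizontal connection: `D_X Y` is the orthogonal projection of `∇_X Y` to the
distribution. -/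
def horizontalConnection (X Y : VField m M) (x : M) : TangentSpace (𝓡 m) x :=
  (S.at' x).starProjection (leviCivita X Y x)

/-- `X` is a smooth orthonormal frame of the distribution on the open set `U`. -/
structure IsOrthonormalFrameOn (U : Set M) (X : Fin k → VField m M) : Prop where
  isOpen : IsOpen U
  smooth : ∀ i, SmoothFieldOn (X i) U
  mem : ∀ i, ∀ x ∈ U, X i x ∈ S.at' x
  orthonormal : ∀ x ∈ U, Orthonormal ℝ (fun i => X i x)

/-- The Christoffel symbol `Γ^r_{ij}` of the horizontal connection in an orthonormal frame:
`D_{X_i} X_j = ∑ r, Γ^r_{ij} X_r`. -/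
def christoffel (X : Fin k → VField m M) (i j r : Fin k) (x : M) : ℝ :=
  inner ℝ (S.horizontalConnection (X i) (X j) x) (X r x)

/-- The horizontal covariant derivative along the curve `γ` of a horizontal vector field `Y`
along `γ`, computed in the orthonormal frame `X`:
`D Y / dt = ∑ r, (dY^r/dt + ∑ i j, γ'^i Y^j Γ^r_{ij}) X_r`. -/
def covDerivAlong (X : Fin k → VField m M) (γ : ℝ → M) (Y : (t : ℝ) → TangentSpace (𝓡 m) (γ t))
    (t : ℝ) : TangentSpace (𝓡 m) (γ t) :=
  ∑ r, (deriv (fun s => inner ℝ (Y s) (X r (γ s))) t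
      + ∑ i, ∑ j, inner ℝ (velocity γ t) (X i (γ t)) * inner ℝ (Y t) (X j (γ t)) *
          S.christoffel X i j r (γ t)) • X r (γ t)

/-- `γ` restricted to `[a, b]` is a nonholonomic geodesic: it is smooth on `[a, b]` (up to the end
points), its velocity is horizontal, and `D_{γ'} γ' = 0`. By smoothness it is enough to require
the last two conditions in the interior of the interval. The vanishing of `D_{γ'} γ'` at `t` does
not depend on the orthonormal frame (defined near `γ t`) in which it is computed. -/
structure IsNonholonomicGeodesicOn (γ : ℝ → M) (a b : ℝ) : Prop where
  smooth : ContMDiffOn 𝓘(ℝ, ℝ) (𝓡 m) ∞ γ (Icc a b)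
  horizontal : ∀ t ∈ Ioo a b, velocity γ t ∈ S.at' (γ t)
  geodesic : ∀ t ∈ Ioo a b, ∃ (U : Set M) (X : Fin k → VField m M),
    S.IsOrthonormalFrameOn U X ∧ γ t ∈ U ∧ S.covDerivAlong X γ (velocity γ) t = 0

/-- `γ` restricted to `[a, b]` is a broken geodesic: it is continuous and there is a subdivision
`a = t 0 < t 1 < ... < t n = b` such that `γ` is a nonholonomic geodesic on each
`[t i, t (i + 1)]`. -/
def IsBrokenGeodesicOn (γ : ℝ → M) (a b : ℝ) : Prop :=
  a < b ∧ ContinuousOn γ (Icc a b) ∧ ∃ (n : ℕ) (t : ℕ → ℝ), t 0 = a ∧ t n = b ∧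
    ∀ i < n, t i < t (i + 1) ∧ S.IsNonholonomicGeodesicOn γ (t i) (t (i + 1))

/-- `d_H(p, q)`: the infimum of the lengths `∫ ‖γ'(t)‖ dt` of the broken geodesics from `p` to `q`,
as an extended nonnegative real number (it is `∞` if there is none). -/
def dH (p q : M) : ℝ≥0∞ :=
  ⨅ (γ : ℝ → M) (a : ℝ) (b : ℝ) (_ : S.IsBrokenGeodesicOn γ a b ∧ γ a = p ∧ γ b = q),
    pathELength (𝓡 m) γ a b

end Distribution

end Metric

end SubRiem

end

/-! In a chart and in a smooth orthonormal frame `X i` of the distribution, a nonholonomic geodesic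
is a solution of the first-order system `x' = ∑ uᵢ Xᵢ`, `u'ᵣ = -∑ uᵢ uⱼ Γʳᵢⱼ`. Let `H i (x, t)` be
the position at time `t` of the geodesic issuing from `x` with velocity `X i x`. Then `H i (x, 0) =
x` and `∂ₜ H i (x, 0) = X i x`, and `H i` is of class `C²`. The maps `H i (·, t)` need not form a
one-parameter group, so commutators of flows are replaced by an orbit argument that uses only this
first-order information.

Being joined by a chain of geodesics is an equivalence relation, because constants are geodesics and
geodesics can be reversed. Inside the class of `p₀` one grows immersions `G`, starting from the
point `p₀` itself. If some `X i` fails to be tangent to `G` at a point `s₁` close to the base point,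
then `(s, t) ↦ H i (G s, t)` is an immersion at `(s₁, 0)` of one dimension more. If all `X i` are
tangent to `G`, so are their iterated brackets (`lieBracket_mem_range_fderiv`); bracket generation
then makes `dG` surjective, and the class of `p₀` is a neighbourhood of a point `G s₀`. Following
the same pieces from starting points near `p₀` carries this back: all points near `p₀` are in its
class. The dimension cannot grow for ever, so the second case occurs
(`eventually_related_of_noTangentImmersion`). Classes are therefore open, and connectedness leaves
only one.

The analytic inputs are the `C²` dependence on initial data (`exists_local_flow`, by the inverse
function theorem in a space of curves) and the smoothness of the Christoffel symbols
(`contMDiffOn_christoffel`, by the Koszul formula). For the distance, symmetry and the triangle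
inequality come from reversing and concatenating chains, finiteness from smoothness up to the end
points, and definiteness from `riemannianEDist_le_dH`. -/

open Filter Topology

noncomputable section

namespace SubRiem

/-! ### Smoothness of composition operators on spaces of continuous functions -/

section Superposition

variable {K : Type*} [TopologicalSpace K] [CompactSpace K]

/-- The continuous bilinear operation on spaces of continuous functions given by the pointwise
application of a continuous bilinear map. -/
def pointwiseBilin (K : Type*) [TopologicalSpace K] [CompactSpace K]
    {G E F : Type*} [NormedAddCommGroup G] [NormedSpace ℝ G] [NormedAddCommGroup E]
    [NormedSpace ℝ E] [NormedAddCommGroup F] [NormedSpace ℝ F] (B : G →L[ℝ] E →L[ℝ] F) :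
    C(K, G) →L[ℝ] C(K, E) →L[ℝ] C(K, F) :=
  LinearMap.mkContinuous₂
    (LinearMap.mk₂ ℝ (fun A h => (⟨fun t => B (A t) (h t),
        (B.continuous.comp A.continuous).clm_apply h.continuous⟩ : C(K, F)))
      (fun _ _ _ => by ext; simp) (fun _ _ _ => by ext; simp)
      (fun _ _ _ => by ext; simp) (fun _ _ _ => by ext; simp)) ‖B‖
    (fun A h => by
      refine (ContinuousMap.norm_le _ (by positivity)).2 fun t => ?_
      exact B.le_of_opNorm₂_le_of_le le_rfl (A.norm_coe_le_norm t) (h.norm_coe_le_norm t))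

@[simp] lemma pointwiseBilin_apply {G E F : Type*} [NormedAddCommGroup G] [NormedSpace ℝ G]
    [NormedAddCommGroup E] [NormedSpace ℝ E] [NormedAddCommGroup F] [NormedSpace ℝ F]
    (B : G →L[ℝ] E →L[ℝ] F) (A : C(K, G)) (h : C(K, E)) (t : K) :
    pointwiseBilin K B A h t = B (A t) (h t) := rfl

/-- The mean value inequality is applied at each `t`, with a bound uniform in `t`: since `K` is
compact, composition with `g'` is continuous for the sup norm. -/
lemma hasFDerivAt_superposition {G E F : Type*} [NormedAddCommGroup G] [NormedSpace ℝ G]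
    [NormedAddCommGroup E] [NormedSpace ℝ E] [NormedAddCommGroup F] [NormedSpace ℝ F]
    (B : G →L[ℝ] E →L[ℝ] F) (g : C(E, F)) (g' : C(E, G))
    (hg : ∀ x, HasFDerivAt g (B (g' x)) x) (c : C(K, E)) :
    HasFDerivAt (fun c : C(K, E) => g.comp c) (pointwiseBilin K B (g'.comp c)) c := by
  rw [hasFDerivAt_iff_isLittleO_nhds_zero, Asymptotics.isLittleO_iff]
  intro ε hε
  have hcont : Tendsto (fun d : C(K, E) => g'.comp d) (𝓝 c) (𝓝 (g'.comp c)) :=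
    (ContinuousMap.continuous_postcomp g').continuousAt
  obtain ⟨η, hη, hηε⟩ : ∃ η : ℝ, 0 < η ∧ ‖B‖ * η ≤ ε :=
    ⟨ε / (‖B‖ + 1), by positivity, by
      rw [mul_div_assoc', div_le_iff₀ (by positivity)]; nlinarith [norm_nonneg B]⟩
  obtain ⟨δ, hδ, hball⟩ := Metric.eventually_nhds_iff.1 (hcont.eventually
    (Metric.ball_mem_nhds _ hη))
  filter_upwards [Metric.ball_mem_nhds (0 : C(K, E)) hδ] with h hh
  rw [mem_ball_zero_iff] at hh
  refine (ContinuousMap.norm_le _ (by positivity)).2 fun t => ?_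
  have key : ∀ y ∈ Metric.closedBall (c t) ‖h‖, ‖B (g' y) - B (g' (c t))‖ ≤ ε := by
    intro y hy
    -- The translate of `c` through `y` at `t` is uniformly close to `c`, so evaluating `g' ∘ d - g'
    -- ∘ c` at `t` gives the bound. This replaces uniform continuity of `g'`, which may fail when
    -- `E` has infinite dimension.
    let d : C(K, E) := c + ContinuousMap.const K (y - c t)
    have hd : dist d c < δ := by
      rw [dist_eq_norm]
      refine lt_of_le_of_lt ((ContinuousMap.norm_le _ (norm_nonneg h)).2 fun s => ?_) hh
      simpa [d, dist_eq_norm] using hy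
    have h1 := hball hd
    rw [dist_eq_norm] at h1
    have h2 := (ContinuousMap.norm_coe_le_norm (g'.comp d - g'.comp c) t).trans h1.le
    have h3 : ‖g' y - g' (c t)‖ ≤ η := by simpa [d] using h2
    rw [← map_sub]
    exact (B.le_opNorm_of_le h3).trans hηε
  have hmv := (convex_closedBall (c t) ‖h‖).norm_image_sub_le_of_norm_hasFDerivWithin_le'
    (f := g) (f' := fun y => B (g' y)) (φ := B (g' (c t))) (C := ε) (x := c t) (y := c t + h t)
    (fun y _ => (hg y).hasFDerivWithinAt) key (by simp)
    (by simpa using h.norm_coe_le_norm t)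
  simp only [add_sub_cancel_left] at hmv
  calc _ = ‖g (c t + h t) - g (c t) - (B (g' (c t))) (h t)‖ := by simp
    _ ≤ ε * ‖h t‖ := hmv
    _ ≤ ε * ‖h‖ := by gcongr; exact h.norm_coe_le_norm t

universe u

/-- Induction on the order: the derivative is pointwise application of the composition operator of
`fderiv ℝ g`, which is one order less smooth. `E` and `F` share a universe so that the induction
hypothesis applies to the target `E →L[ℝ] F`. -/
theorem contDiff_superposition {E : Type u} [NormedAddCommGroup E] [NormedSpace ℝ E] (n : ℕ) :
    ∀ {F : Type u} [NormedAddCommGroup F] [NormedSpace ℝ F]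
    (g : C(E, F)), ContDiff ℝ n g → ContDiff ℝ n (fun c : C(K, E) => g.comp c) := by
  induction n with
  | zero =>
    intro F _ _ g _
    exact contDiff_zero.2 (ContinuousMap.continuous_postcomp g)
  | succ n ih =>
    intro F _ _ g hg
    have hg1 : ContDiff ℝ n (fderiv ℝ g) := hg.fderiv_right (by norm_cast)
    let g' : C(E, E →L[ℝ] F) := ⟨fderiv ℝ g, hg1.continuous⟩
    have key := hasFDerivAt_superposition (K := K) (ContinuousLinearMap.id ℝ (E →L[ℝ] F)) g g'
      fun x => (hg.differentiable (by norm_cast) x).hasFDerivAt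
    push_cast
    rw [contDiff_succ_iff_fderiv]
    refine ⟨fun c => (key c).differentiableAt, by simp, ?_⟩
    rw [funext fun c => (key c).fderiv]
    exact (pointwiseBilin K (ContinuousLinearMap.id ℝ (E →L[ℝ] F))).contDiff.comp (ih g' hg1)

end Superposition

/-! ### Dependence of solutions of an ODE on initial point and time -/

section Flow

variable {E : Type*} [NormedAddCommGroup E] [NormedSpace ℝ E]

/-- Integration from `0`, as a continuous linear operator on the continuous functions on the unit
interval. -/
def volterra (E : Type*) [NormedAddCommGroup E] [NormedSpace ℝ E] :
    C(Icc (0 : ℝ) 1, E) →L[ℝ] C(Icc (0 : ℝ) 1, E) :=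
  have hint : ∀ (h : C(Icc (0 : ℝ) 1, E)) (a b : ℝ),
      IntervalIntegrable (IccExtend zero_le_one h) MeasureTheory.volume a b := fun h a b =>
    (h.continuous.Icc_extend' (h := zero_le_one)).intervalIntegrable _ _
  LinearMap.mkContinuous
    { toFun := fun h => ⟨fun t => ∫ s in (0 : ℝ)..t, IccExtend zero_le_one h s,
        (intervalIntegral.continuous_primitive (hint h) 0).comp continuous_subtype_val⟩
      map_add' := fun h k => by
        ext t
        simp only [ContinuousMap.coe_mk, ContinuousMap.add_apply]
        rw [← intervalIntegral.integral_add (hint h _ _) (hint k _ _)]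
        rfl
      map_smul' := fun r h => by
        ext t
        simp only [ContinuousMap.coe_mk, ContinuousMap.smul_apply, RingHom.id_apply]
        rw [← intervalIntegral.integral_smul]
        rfl } 1
    (fun h => by
      rw [one_mul]
      refine (ContinuousMap.norm_le _ (by positivity)).2 fun t => ?_
      have h1 := intervalIntegral.norm_integral_le_of_norm_le_const (a := 0) (b := (t : ℝ))
        (f := IccExtend zero_le_one h) (C := ‖h‖) (fun s _ => h.norm_coe_le_norm _)
      refine h1.trans ?_
      rw [sub_zero, abs_of_nonneg t.2.1]
      exact mul_le_of_le_one_right (norm_nonneg _) t.2.2)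

lemma volterra_apply (h : C(Icc (0 : ℝ) 1, E)) (t : Icc (0 : ℝ) 1) :
    volterra E h t = ∫ s in (0 : ℝ)..t, IccExtend zero_le_one h s := rfl


lemma volterra_hasDerivWithinAt (h : C(Icc (0 : ℝ) 1, E)) [CompleteSpace E] {t : ℝ}
    (ht : t ∈ Icc (0 : ℝ) 1) :
    HasDerivWithinAt (IccExtend zero_le_one (volterra E h)) (h ⟨t, ht⟩) (Icc 0 1) t := by
  have hc : Continuous (IccExtend zero_le_one h) := h.continuous.Icc_extend'
  have h1 : HasDerivAt (fun u => ∫ s in (0 : ℝ)..u, IccExtend zero_le_one h s)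
      (IccExtend zero_le_one h t) t :=
    intervalIntegral.integral_hasDerivAt_right (hc.intervalIntegrable _ _)
      (hc.stronglyMeasurableAtFilter _ _) hc.continuousAt
  rw [IccExtend_of_mem _ _ ht] at h1
  refine h1.hasDerivWithinAt.congr (fun s hs => ?_) ?_
  · rw [IccExtend_of_mem _ _ hs, volterra_apply]
  · rw [IccExtend_of_mem _ _ ht, volterra_apply]

/-- The space of continuous curves parametrized by the unit interval. -/
local notation "𝒞" => C(Icc (0 : ℝ) 1, E)

/-- The inverse function theorem for `(z, ε, c) ↦ (z, ε, c - z - ε ∫ g ∘ c)`. Scaling time by `ε`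
keeps all solutions on the fixed interval `[0, 1]` and makes the problem trivial at `ε = 0`, where
`c` is constant. -/
theorem exists_contDiffAt_solution [CompleteSpace E] (g : C(E, E)) (hg : ContDiff ℝ 2 g) (z₀ : E) :
    ∃ c : E × ℝ → 𝒞, ContDiffAt ℝ 2 c (z₀, 0) ∧ c (z₀, 0) = ContinuousMap.const _ z₀ ∧
      ∀ᶠ p in 𝓝 (z₀, (0 : ℝ)),
        c p = ContinuousMap.const _ p.1 + p.2 • volterra E (g.comp (c p)) := by
  have hN : ContDiff ℝ 2 (fun c : 𝒞 => g.comp c) := contDiff_superposition 2 g hg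
  let cst : E →L[ℝ] 𝒞 := LinearMap.mkContinuous
    { toFun := fun z => ContinuousMap.const _ z
      map_add' := fun _ _ => rfl
      map_smul' := fun _ _ => rfl } 1
    (fun z => by
      rw [one_mul]
      exact (ContinuousMap.norm_le _ (norm_nonneg z)).2 fun t => le_rfl)
  have hcst : ∀ z, cst z = ContinuousMap.const _ z := fun _ => rfl
  let T : 𝒞 → 𝒞 := fun c => volterra E (g.comp c)
  have hT : ContDiff ℝ 2 T := (volterra E).contDiff.comp hN
  let Ψ : (E × ℝ) × 𝒞 → (E × ℝ) × 𝒞 := fun q => (q.1, q.2 - cst q.1.1 - q.1.2 • T q.2)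
  have hΨ : ContDiff ℝ 2 Ψ := by
    refine contDiff_fst.prodMk ((contDiff_snd.sub (cst.contDiff.comp
      (contDiff_fst.comp contDiff_fst))).sub ?_)
    exact (contDiff_snd.comp contDiff_fst).smul (hT.comp contDiff_snd)
  let c₀ : 𝒞 := ContinuousMap.const _ z₀
  let q₀ : (E × ℝ) × 𝒞 := ((z₀, 0), c₀)
  let L : (E × ℝ) →L[ℝ] 𝒞 := cst.comp (ContinuousLinearMap.fst ℝ E ℝ)
    + (ContinuousLinearMap.snd ℝ E ℝ).smulRight (T c₀)
  -- At `ε = 0` the derivative of `T` drops out, so the linearization is a shear; changing the sign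
  -- of `L` inverts it.
  let Φ : ((E × ℝ) × 𝒞) ≃L[ℝ] ((E × ℝ) × 𝒞) :=
    ContinuousLinearEquiv.equivOfInverse
      ((ContinuousLinearMap.fst ℝ (E × ℝ) 𝒞).prod (ContinuousLinearMap.snd ℝ (E × ℝ) 𝒞
        - L.comp (ContinuousLinearMap.fst ℝ (E × ℝ) 𝒞)))
      ((ContinuousLinearMap.fst ℝ (E × ℝ) 𝒞).prod (ContinuousLinearMap.snd ℝ (E × ℝ) 𝒞
        + L.comp (ContinuousLinearMap.fst ℝ (E × ℝ) 𝒞)))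
      (fun q => by simp) (fun q => by simp)
  have hΦ : HasFDerivAt Ψ (Φ : ((E × ℝ) × 𝒞) →L[ℝ] ((E × ℝ) × 𝒞)) q₀ := by
    have h1 : HasFDerivAt T (fderiv ℝ T c₀) c₀ := (hT.differentiable (by norm_num) c₀).hasFDerivAt
    have h2 : HasFDerivAt (fun q : (E × ℝ) × 𝒞 => T q.2)
        ((fderiv ℝ T c₀).comp (ContinuousLinearMap.snd ℝ (E × ℝ) 𝒞)) q₀ :=
      HasFDerivAt.comp (g := T) q₀ h1 hasFDerivAt_snd
    have h3 : HasFDerivAt (fun q : (E × ℝ) × 𝒞 => q.1.2)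
        ((ContinuousLinearMap.snd ℝ E ℝ).comp (ContinuousLinearMap.fst ℝ (E × ℝ) 𝒞)) q₀ :=
      ((ContinuousLinearMap.snd ℝ E ℝ).comp (ContinuousLinearMap.fst ℝ (E × ℝ) 𝒞)).hasFDerivAt
    have h4 : HasFDerivAt (fun q : (E × ℝ) × 𝒞 => cst q.1.1)
        (cst.comp ((ContinuousLinearMap.fst ℝ E ℝ).comp (ContinuousLinearMap.fst ℝ (E × ℝ) 𝒞)))
        q₀ :=
      (cst.comp ((ContinuousLinearMap.fst ℝ E ℝ).comp
        (ContinuousLinearMap.fst ℝ (E × ℝ) 𝒞))).hasFDerivAt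
    have h5 := (hasFDerivAt_fst (𝕜 := ℝ) (p := q₀)).prodMk
      (((hasFDerivAt_snd (𝕜 := ℝ) (p := q₀)).sub h4).sub (h3.smul h2))
    refine h5.congr_fderiv ?_
    apply ContinuousLinearMap.ext
    rintro ⟨⟨z, e⟩, c⟩
    simp [Φ, L, q₀, sub_sub]
  have hq : Ψ q₀ = ((z₀, 0), 0) := by simp [Ψ, q₀, hcst, c₀]
  let inv := hΨ.contDiffAt.localInverse hΦ (by norm_num : (2 : WithTop ℕ∞) ≠ 0)
  have hinv : ContDiffAt ℝ 2 inv ((z₀, 0), 0) :=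
    hq ▸ hΨ.contDiffAt.to_localInverse hΦ (by norm_num)
  have hstrict := hΨ.contDiffAt.hasStrictFDerivAt' hΦ (by norm_num : (2 : WithTop ℕ∞) ≠ 0)
  have hright : ∀ᶠ y in 𝓝 (Ψ q₀), Ψ (inv y) = y := hstrict.eventually_right_inverse
  have hleft : inv (Ψ q₀) = q₀ := hstrict.localInverse_apply_image
  rw [hq] at hright hleft
  let emb : E × ℝ → (E × ℝ) × 𝒞 := fun p => (p, 0)
  have hemb : ContDiff ℝ 2 emb := contDiff_id.prodMk contDiff_const
  refine ⟨fun p => (inv (emb p)).2, ?_, by simp [emb, hleft, q₀, c₀], ?_⟩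
  · exact contDiffAt_snd.comp _ (ContDiffAt.comp (z₀, (0 : ℝ)) hinv hemb.contDiffAt)
  · filter_upwards [(hemb.continuous.tendsto (z₀, (0 : ℝ))).eventually hright] with p hp
    have h1 : (inv (emb p)).1 = p := congrArg Prod.fst hp
    have h2 : (inv (emb p)).2 - cst (inv (emb p)).1.1 - (inv (emb p)).1.2 • T (inv (emb p)).2 = 0 :=
      congrArg Prod.snd hp
    rw [h1, sub_sub, sub_eq_zero] at h2
    exact h2

/-- The local flow of a smooth vector field, in rescaled time: `c z ε τ` is the value at time
`ε * τ` of the solution that starts at `z`. -/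
theorem exists_local_flow [FiniteDimensional ℝ E] {f : E → E} {Ω : Set E} (hΩ : IsOpen Ω)
    (hf : ContDiffOn ℝ ∞ f Ω) {z₀ : E} (hz₀ : z₀ ∈ Ω) :
    ∃ (c : E → ℝ → ℝ → E) (N : Set E) (δ : ℝ), IsOpen N ∧ z₀ ∈ N ∧ 0 < δ ∧
      (∀ z ∈ N, ∀ ε ∈ Ioo (-δ) δ, MapsTo (c z ε) (Icc 0 1) Ω ∧ c z ε 0 = z ∧
        ∀ τ ∈ Icc (0 : ℝ) 1, HasDerivWithinAt (c z ε) (ε • f (c z ε τ)) (Icc 0 1) τ) ∧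
      (∀ z ∈ N, c z 0 1 = z) ∧ (∀ z ∈ N, HasDerivAt (fun ε => c z ε 1) (f z) 0) ∧
      ContDiffOn ℝ 2 (fun p : E × ℝ => c p.1 p.2 1) (N ×ˢ Ioo (-δ) δ) := by
  have : CompleteSpace E := FiniteDimensional.complete ℝ E
  obtain ⟨r, hr, hrΩ⟩ := Metric.nhds_basis_closedBall.mem_iff.1 (hΩ.mem_nhds hz₀)
  -- The cutoff makes the field global. Solutions close to the constant `z₀` stay in the ball of
  -- radius `r / 2`, where the cutoff is `1`, and so solve the original equation.
  let b : ContDiffBump z₀ := ⟨r / 2, r, by positivity, by linarith⟩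
  have hgc : ContDiff ℝ ∞ (fun z => b z • f z) := by
    rw [contDiff_iff_contDiffAt]
    intro z
    by_cases hz : z ∈ Metric.closedBall z₀ r
    · exact b.contDiff.contDiffAt.smul (hf.contDiffAt (hΩ.mem_nhds (hrΩ hz)))
    · refine (contDiffAt_const (c := (0 : E))).congr_of_eventuallyEq ?_
      filter_upwards [Metric.isClosed_closedBall.isOpen_compl.mem_nhds hz] with y hy
      rw [b.zero_of_le_dist ((not_le.1 (mt Metric.mem_closedBall.2 hy)).le), zero_smul]
  let g : C(E, E) := ⟨fun z => b z • f z, hgc.continuous⟩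
  have hgf : ∀ z ∈ Metric.ball z₀ (r / 2), g z = f z := fun z hz => by
    change b z • f z = f z
    rw [b.one_of_mem_closedBall (Metric.ball_subset_closedBall hz), one_smul]
  have hg2 : ContDiff ℝ 2 g := contDiff_infty.1 hgc 2
  obtain ⟨c, hc, hc0, hceq⟩ := exists_contDiffAt_solution g hg2 z₀
  have hnear : ∀ᶠ p in 𝓝 (z₀, (0 : ℝ)), c p ∈ Metric.ball (c (z₀, 0)) (r / 2) :=
    hc.continuousAt.eventually (Metric.ball_mem_nhds _ (by positivity))
  have hall := (hc.eventually (by simp)).and (hceq.and hnear)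
  rw [nhds_prod_eq] at hall
  obtain ⟨P, hP, Q, hQ, hPQ⟩ := Filter.eventually_prod_iff.1 hall
  obtain ⟨N, hNP, hNo, hzN⟩ := eventually_nhds_iff.1 hP
  obtain ⟨δ, hδ, hδQ⟩ := Metric.eventually_nhds_iff.1 hQ
  have hQ' : ∀ ε ∈ Ioo (-δ) δ, Q ε := fun ε hε => hδQ (by
    rw [Real.dist_0_eq_abs]; exact abs_lt.2 hε)
  have hA := fun z (hz : z ∈ N) ε (hε : ε ∈ Ioo (-δ) δ) => hPQ (hNP z hz) (hQ' ε hε)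
  have h0 : (0 : ℝ) ∈ Ioo (-δ) δ := ⟨by linarith, hδ⟩
  have hball : ∀ z ∈ N, ∀ ε ∈ Ioo (-δ) δ, ∀ t, c (z, ε) t ∈ Metric.ball z₀ (r / 2) := by
    intro z hz ε hε t
    have h1 := (hA z hz ε hε).2.2
    rw [hc0, Metric.mem_ball, ContinuousMap.dist_lt_iff (by positivity)] at h1
    exact h1 t
  have hone : ∀ p, IccExtend zero_le_one (c p) 1 = c p ⟨1, by simp⟩ := fun p =>
    IccExtend_of_mem _ _ (by simp)
  have hzero : ∀ z ∈ N, c (z, 0) = ContinuousMap.const _ z := fun z hz => by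
    have := (hA z hz 0 h0).2.1
    simpa using this
  let ev : C(Icc (0 : ℝ) 1, E) →L[ℝ] E :=
    ContinuousMap.evalCLM ℝ (⟨1, by simp⟩ : Icc (0 : ℝ) 1)
  refine ⟨fun z ε => IccExtend zero_le_one (c (z, ε)), N, δ, hNo, hzN, hδ, ?_, ?_, ?_, ?_⟩
  · intro z hz ε hε
    beta_reduce
    have heq := (hA z hz ε hε).2.1
    refine ⟨fun τ hτ => ?_, ?_, fun τ hτ => ?_⟩
    · rw [IccExtend_of_mem _ _ hτ]
      refine hrΩ (Metric.ball_subset_closedBall.trans (Metric.closedBall_subset_closedBall ?_)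
        (hball z hz ε hε _))
      linarith
    · rw [IccExtend_of_mem _ _ (by simp : (0 : ℝ) ∈ Icc (0 : ℝ) 1), heq]
      simp [volterra_apply]
    · have h1 := ((volterra_hasDerivWithinAt (g.comp (c (z, ε))) hτ).const_smul ε).const_add z
      rw [IccExtend_of_mem _ _ hτ, ← hgf _ (hball z hz ε hε _)]
      refine h1.congr (fun s hs => ?_) ?_
      · rw [IccExtend_of_mem _ _ hs, Pi.smul_apply, IccExtend_of_mem _ _ hs]
        exact DFunLike.congr_fun heq _
      · rw [IccExtend_of_mem _ _ hτ, Pi.smul_apply, IccExtend_of_mem _ _ hτ]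
        exact DFunLike.congr_fun heq _
  · intro z hz
    beta_reduce
    rw [hone, hzero z hz]
    rfl
  · intro z hz
    -- The integral equation reads `c z ε 1 = z + ε • J ε`, so its derivative at `0` is `J 0`, which
    -- is `f z` because the curve is constant there.
    let J : ℝ → E := fun ε => ev (volterra E (g.comp (c (z, ε))))
    have hJ : DifferentiableAt ℝ J 0 := by
      have h1 : ContDiffAt ℝ 2 (fun ε : ℝ => c (z, ε)) 0 :=
        ContDiffAt.comp (0 : ℝ) (hA z hz 0 h0).1 (contDiffAt_const.prodMk contDiffAt_id)
      have h2 : ContDiff ℝ 2 (fun c : C(Icc (0 : ℝ) 1, E) => ev (volterra E (g.comp c))) :=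
        (ev.comp (volterra E)).contDiff.comp (contDiff_superposition 2 g hg2)
      exact (h2.contDiffAt.comp (0 : ℝ) h1).differentiableAt (by norm_num)
    have hJ0 : J 0 = f z := by
      have h1 : IccExtend zero_le_one (g.comp (c (z, 0))) = fun _ => g z := by
        funext s
        simp [IccExtend, hzero z hz]
      change volterra E (g.comp (c (z, 0))) ⟨1, _⟩ = f z
      rw [volterra_apply, h1, intervalIntegral.integral_const]
      have h2 := hball z hz 0 h0 ⟨1, by simp⟩
      rw [hzero z hz] at h2
      simpa using hgf z h2
    have h1 := ((hasDerivAt_id (0 : ℝ)).smul hJ.hasDerivAt).const_add z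
    simp only [id, zero_smul, one_smul, zero_add, hJ0] at h1
    refine h1.congr_of_eventuallyEq ?_
    filter_upwards [isOpen_Ioo.mem_nhds h0] with ε hε
    rw [hone, (hA z hz ε hε).2.1]
    rfl
  · rintro ⟨z, ε⟩ ⟨hz, hε⟩
    have h1 : ContDiffAt ℝ 2 (fun p : E × ℝ => ev (c p)) (z, ε) :=
      ev.contDiff.contDiffAt.comp _ (hA z hz ε hε).1
    refine ContDiffAt.contDiffWithinAt (h1.congr_of_eventuallyEq (Eventually.of_forall fun p => ?_))
    exact hone p

end Flow

/-! ### Fields tangent to immersions and an abstract Chow theorem -/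

section Chow

variable {E : Type*} [NormedAddCommGroup E] [NormedSpace ℝ E] [FiniteDimensional ℝ E]
  {F : Type*} [NormedAddCommGroup F] [NormedSpace ℝ F] [FiniteDimensional ℝ F]

/-- A vector field that is tangent to an immersion `G` is `G`-related to a vector field on the
source of `G`. -/
lemma exists_related_field {G : F → E} {s₀ : F} (hG : ContDiffAt ℝ 2 G s₀)
    (hinj : Function.Injective (fderiv ℝ G s₀)) {X : E → E} (hX : DifferentiableAt ℝ X (G s₀))
    (htan : ∀ᶠ s in 𝓝 s₀, X (G s) ∈ (fderiv ℝ G s).range) :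
    ∃ Y : F → F, DifferentiableAt ℝ Y s₀ ∧ ∀ᶠ s in 𝓝 s₀, fderiv ℝ G s (Y s) = X (G s) := by
  have : CompleteSpace F := FiniteDimensional.complete ℝ F
  obtain ⟨l, hl⟩ := (fderiv ℝ G s₀).toLinearMap.exists_leftInverse_of_injective
    (LinearMap.ker_eq_bot.2 hinj)
  let L : E →L[ℝ] F := l.toContinuousLinearMap
  have hdA : DifferentiableAt ℝ (fderiv ℝ G) s₀ :=
    (hG.fderiv_right (m := 1) (by norm_num)).differentiableAt (by norm_num)
  -- `L` is a left inverse of `dG` at `s₀`, so `B` is invertible nearby, and `dG y = X ∘ G` is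
  -- solved by `y = B⁻¹ L (X ∘ G)`, which is differentiable in `s`.
  let B : F → (F →L[ℝ] F) := fun s => L.comp (fderiv ℝ G s)
  have hB0 : B s₀ = 1 := by
    ext v
    exact LinearMap.congr_fun hl v
  have hdB : DifferentiableAt ℝ B s₀ := (differentiableAt_const L).clm_comp hdA
  have hinv : DifferentiableAt ℝ (fun s => Ring.inverse (B s)) s₀ := by
    have h1 : DifferentiableAt ℝ (Ring.inverse : (F →L[ℝ] F) → _) (B s₀) := by
      rw [hB0]
      exact differentiableAt_inverse isUnit_one
    exact h1.comp s₀ hdB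
  have hunit : ∀ᶠ s in 𝓝 s₀, IsUnit (B s) :=
    hdB.continuousAt.eventually (Units.isOpen.mem_nhds (by rw [hB0]; exact isUnit_one))
  refine ⟨fun s => Ring.inverse (B s) (L (X (G s))), ?_, ?_⟩
  · have hXG : DifferentiableAt ℝ (fun s => X (G s)) s₀ :=
      hX.comp s₀ (hG.differentiableAt (by norm_num))
    exact hinv.clm_apply (L.differentiableAt.comp s₀ hXG)
  · filter_upwards [hunit, htan] with s hs ⟨y, hy⟩
    rw [← hy]
    have h1 : Ring.inverse (B s) (B s y) = y := by
      rw [← mul_apply_eq_comp, Ring.inverse_mul_cancel _ hs]; rfl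
    exact congrArg (fderiv ℝ G s) h1

/-- The Lie bracket of two vector fields that are tangent to an immersion is tangent to it. -/
theorem lieBracket_mem_range_fderiv {G : F → E} {s₀ : F} (hG : ContDiffAt ℝ 2 G s₀)
    (hinj : Function.Injective (fderiv ℝ G s₀)) {X X' : E → E}
    (hX : DifferentiableAt ℝ X (G s₀)) (hX' : DifferentiableAt ℝ X' (G s₀))
    (htan : ∀ᶠ s in 𝓝 s₀, X (G s) ∈ (fderiv ℝ G s).range)
    (htan' : ∀ᶠ s in 𝓝 s₀, X' (G s) ∈ (fderiv ℝ G s).range) :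
    VectorField.lieBracket ℝ X X' (G s₀) ∈ (fderiv ℝ G s₀).range := by
  obtain ⟨Y, hY, hYX⟩ := exists_related_field hG hinj hX htan
  obtain ⟨Y', hY', hYX'⟩ := exists_related_field hG hinj hX' htan'
  have hdG : DifferentiableAt ℝ G s₀ := hG.differentiableAt (by norm_num)
  have hdA : DifferentiableAt ℝ (fderiv ℝ G) s₀ :=
    (hG.fderiv_right (m := 1) (by norm_num)).differentiableAt (by norm_num)
  -- This is the derivative of the relation `dG (Y) = X ∘ G`. In the bracket the two second
  -- derivatives of `G` cancel by symmetry, which is why immersions are taken `C²`, and `dG` of the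
  -- bracket of `Y` and `Y'` remains.
  have key : ∀ {X : E → E} {Y : F → F}, DifferentiableAt ℝ X (G s₀) → DifferentiableAt ℝ Y s₀ →
      (∀ᶠ s in 𝓝 s₀, fderiv ℝ G s (Y s) = X (G s)) → ∀ v,
      fderiv ℝ X (G s₀) (fderiv ℝ G s₀ v)
        = fderiv ℝ (fderiv ℝ G) s₀ v (Y s₀) + fderiv ℝ G s₀ (fderiv ℝ Y s₀ v) := by
    intro X Y hX hY h v
    have h1 : HasFDerivAt (fun s => fderiv ℝ G s (Y s)) _ s₀ :=
      hdA.hasFDerivAt.clm_apply hY.hasFDerivAt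
    have h2 : HasFDerivAt (fun s => X (G s)) _ s₀ := hX.hasFDerivAt.comp s₀ hdG.hasFDerivAt
    have h3 := (h2.congr_of_eventuallyEq h).unique h1
    have h4 := congrArg (fun T : F →L[ℝ] E => T v) h3
    simp only [ContinuousLinearMap.comp_apply, add_apply,
      ContinuousLinearMap.flip_apply] at h4
    rw [h4, add_comm]
  have hsymm := (hG.isSymmSndFDerivAt (by simp)).eq (Y s₀) (Y' s₀)
  refine ⟨fderiv ℝ Y' s₀ (Y s₀) - fderiv ℝ Y s₀ (Y' s₀), ?_⟩
  rw [VectorField.lieBracket, ← hYX.self_of_nhds, ← hYX'.self_of_nhds, key hX' hY' hYX',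
    key hX hY hYX, hsymm]
  simp

/-- No germ at `x` of an immersion of positive codimension is tangent to all the vector
fields `X i`. -/
def NoTangentImmersion {ι : Type*} (X : ι → E → E) (x : E) : Prop :=
  ∀ (F : Type) [NormedAddCommGroup F] [NormedSpace ℝ F] [FiniteDimensional ℝ F] (G : F → E)
    (s₀ : F), G s₀ = x → ContDiffAt ℝ 2 G s₀ → Function.Injective (fderiv ℝ G s₀) →
    (∀ᶠ s in 𝓝 s₀, ∀ i, X i (G s) ∈ (fderiv ℝ G s).range) → (fderiv ℝ G s₀).range = ⊤

/-- An abstract form of Chow's theorem: an equivalence relation that contains the pairs `(x, y)`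
such that `y` lies on the curve `t ↦ H i x t` starting at `x` with velocity `X i x` has open
classes, when no immersion of positive codimension is tangent to all the `X i`. -/
theorem eventually_related_of_noTangentImmersion {ι : Type*} {X : ι → E → E}
    {H : ι → E × ℝ → E} {V : Set E} (hV : IsOpen V) {R : E → E → Prop} (hR : Equivalence R)
    (hX : ∀ x ∈ V, NoTangentImmersion X x)
    (hH : ∀ i, ∀ x ∈ V, ContDiffAt ℝ 2 (H i) (x, 0))
    (hH0 : ∀ i, ∀ x ∈ V, H i (x, 0) = x)
    (hH' : ∀ i, ∀ x ∈ V, HasDerivAt (fun t => H i (x, t)) (X i x) 0)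
    (hHR : ∀ i, ∀ x ∈ V, ∀ᶠ p in 𝓝 (x, (0 : ℝ)), R p.1 (H i p)) {p₀ : E} (hp₀ : p₀ ∈ V) :
    ∀ᶠ x in 𝓝 p₀, R p₀ x := by
  by_contra hcon
  -- `Q w` says that points near `p₀` can be steered close to `w`. It brings openness of the class,
  -- found at a far point `G s`, back to `p₀`.
  let Q : E → Prop := fun w => ∀ W ∈ 𝓝 w, ∀ᶠ x in 𝓝 p₀, ∃ y ∈ W, R x y
  let Good : ℕ → Prop := fun j => ∃ (F : Type) (_ : NormedAddCommGroup F) (_ : NormedSpace ℝ F)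
    (_ : FiniteDimensional ℝ F) (G : F → E) (s₀ : F), Module.finrank ℝ F = j ∧
    ContDiffAt ℝ 2 G s₀ ∧ Function.Injective (fderiv ℝ G s₀) ∧
    ∀ᶠ s in 𝓝 s₀, G s ∈ V ∧ R p₀ (G s) ∧ Q (G s)
  have hgood : ∀ j, Good j := by
    intro j
    induction j with
    | zero =>
      refine ⟨Fin 0 → ℝ, inferInstance, inferInstance, inferInstance, fun _ => p₀, 0, by simp,
        contDiffAt_const, fun a b _ => Subsingleton.elim a b,
        Eventually.of_forall fun _ => ⟨hp₀, hR.refl _, fun W hW => ?_⟩⟩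
      filter_upwards [hW] with x hx using ⟨x, hx, hR.refl x⟩
    | succ j ih =>
      obtain ⟨F, _, _, _, G, s₀, hF, hG, hinj, hev⟩ := ih
      have hcF : CompleteSpace F := FiniteDimensional.complete ℝ F
      have hcE : CompleteSpace E := FiniteDimensional.complete ℝ E
      by_cases htan : ∀ᶠ s in 𝓝 s₀, ∀ i, X i (G s) ∈ (fderiv ℝ G s).range
      · exfalso
        have hsurj := hX (G s₀) hev.self_of_nhds.1 F G s₀ rfl hG hinj htan
        -- A submersion maps neighbourhoods onto neighbourhoods, so the class of `p₀` is a
        -- neighbourhood of `G s₀`; `Q (G s₀)` then contradicts `hcon`.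
        have hmap := (hG.hasStrictFDerivAt (by norm_num)).map_nhds_eq_of_surj hsurj
        have hW : {y | R p₀ y} ∈ 𝓝 (G s₀) := by
          rw [← hmap]
          exact hev.mono fun s hs => hs.2.1
        refine hcon ((hev.self_of_nhds.2.2 _ hW).mono ?_)
        rintro x ⟨y, hy, hxy⟩
        exact hR.trans hy (hR.symm hxy)
      · have hopen : ∀ᶠ s in 𝓝 s₀, Function.Injective (fderiv ℝ G s) :=
          (hG.fderiv_right (m := 1) (by norm_num)).continuousAt.eventually
            (ContinuousLinearMap.isOpen_injective.mem_nhds hinj)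
        -- Tangency may fail only at points other than `s₀`, so the base point moves to a nearby
        -- `s₁`, where all the open conditions persist.
        obtain ⟨s₁, hs₁, hG₁, hinj₁, hev₁⟩ := ((not_eventually.1 htan).and_eventually
          ((hG.eventually (by simp)).and (hopen.and (eventually_eventually_nhds.2 hev)))).exists
        obtain ⟨i, hi⟩ := not_forall.1 hs₁
        have hxV : G s₁ ∈ V := hev₁.self_of_nhds.1
        have hHx := hH i _ hxV
        let L := fderiv ℝ (H i) (G s₁, 0)
        have hL : HasFDerivAt (H i) L (G s₁, 0) :=
          (hHx.differentiableAt (by norm_num)).hasFDerivAt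
        -- With `hL2` this gives `L (v, τ) = v + τ • X i`: the new derivative is injective exactly
        -- because `X i` lies outside the range of the old one.
        have hL1 : ∀ v, L (v, 0) = v := by
          intro v
          have h1 : HasFDerivAt (fun x => H i (x, 0)) _ (G s₁) :=
            HasFDerivAt.comp (g := H i) (f := fun x : E => (x, (0 : ℝ))) (G s₁) hL
              ((hasFDerivAt_id (G s₁)).prodMk (hasFDerivAt_const (0 : ℝ) (G s₁)))
          have h2 : HasFDerivAt (fun x => H i (x, 0)) (ContinuousLinearMap.id ℝ E) (G s₁) :=
            (hasFDerivAt_id (G s₁)).congr_of_eventuallyEq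
              (by filter_upwards [hV.mem_nhds hxV] with x hx using hH0 i x hx)
          exact congrArg (fun T : E →L[ℝ] E => T v) (h1.unique h2)
        have hL2 : L (0, 1) = X i (G s₁) := by
          have h1 : HasDerivAt (fun t => H i (G s₁, t)) (L (0, 1)) 0 :=
            hL.comp_hasDerivAt (0 : ℝ) ((hasDerivAt_const (0 : ℝ) (G s₁)).prodMk (hasDerivAt_id _))
          exact h1.unique (hH' i _ hxV)
        have hpairD : HasFDerivAt (fun q : F × ℝ => (G q.1, q.2)) _ (s₁, (0 : ℝ)) :=
          (HasFDerivAt.comp (s₁, (0 : ℝ)) (hG₁.differentiableAt (by norm_num)).hasFDerivAt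
            hasFDerivAt_fst).prodMk hasFDerivAt_snd
        have hpairC : ContDiffAt ℝ 2 (fun q : F × ℝ => (G q.1, q.2)) (s₁, (0 : ℝ)) :=
          (ContDiffAt.comp (s₁, (0 : ℝ)) hG₁ contDiffAt_fst).prodMk contDiffAt_snd
        have hGD := HasFDerivAt.comp (s₁, (0 : ℝ)) (g := H i) hL hpairD
        refine ⟨F × ℝ, inferInstance, inferInstance, inferInstance, fun q => H i (G q.1, q.2),
          (s₁, 0), by simp [hF], ContDiffAt.comp (s₁, (0 : ℝ)) (g := H i) hHx hpairC, ?_, ?_⟩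
        · rw [show fderiv ℝ (fun q : F × ℝ => H i (G q.1, q.2)) (s₁, 0) = _ from hGD.fderiv]
          rw [injective_iff_map_eq_zero]
          rintro ⟨h, τ⟩ hz
          have hdec : L (fderiv ℝ G s₁ h, τ) = fderiv ℝ G s₁ h + τ • X i (G s₁) := by
            rw [← hL2, ← map_smul]
            nth_rw 2 [← hL1 (fderiv ℝ G s₁ h)]
            rw [← map_add]
            simp
          have hz' : fderiv ℝ G s₁ h + τ • X i (G s₁) = 0 := by
            rw [← hdec]
            exact hz
          have hτ : τ = 0 := by
            by_contra hτ
            refine hi ⟨-(τ⁻¹ • h), ?_⟩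
            have h1 : fderiv ℝ G s₁ h = -(τ • X i (G s₁)) := eq_neg_of_add_eq_zero_left hz'
            simp [h1, hτ]
          subst hτ
          rw [zero_smul, add_zero] at hz'
          rw [Prod.mk_eq_zero]
          exact ⟨hinj₁ (hz'.trans (map_zero _).symm), rfl⟩
        · have hcont := hpairC.continuousAt
          have h1 : ∀ᶠ q : F × ℝ in 𝓝 (s₁, 0), G q.1 ∈ V ∧ R p₀ (G q.1) ∧ Q (G q.1) :=
            (continuous_fst.tendsto (s₁, (0 : ℝ))).eventually hev₁
          have h2 := hcont.eventually (hHx.eventually (by simp))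
          have h3 := hcont.eventually (eventually_eventually_nhds.2 (hHR i _ hxV))
          have h4 : ∀ᶠ q : F × ℝ in 𝓝 (s₁, 0), H i (G q.1, q.2) ∈ V :=
            (ContinuousAt.comp (x := (s₁, (0 : ℝ))) (g := H i) hHx.continuousAt
              hcont).eventually (hV.mem_nhds (by
                simp only [Function.comp, hH0 i _ hxV]; exact hxV))
          filter_upwards [h1, h2, h3, h4] with q hq1 hq2 hq3 hq4
          refine ⟨hq4, hR.trans hq1.2.1 hq3.self_of_nhds, fun W hW => ?_⟩
          have hslice : Tendsto (fun y => (y, q.2)) (𝓝 (G q.1)) (𝓝 (G q.1, q.2)) :=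
            (Continuous.prodMk_left q.2).tendsto _
          -- The target neighbourhood is pulled back along the last step `y ↦ H i (y, q.2)`, and `Q
          -- (G q.1)` steers into the pullback.
          have hW' : {y | H i (y, q.2) ∈ W ∧ R y (H i (y, q.2))} ∈ 𝓝 (G q.1) :=
            (hslice.eventually (hq2.continuousAt.eventually hW)).and (hslice.eventually hq3)
          filter_upwards [hq1.2.2 _ hW'] with x ⟨y, hy, hxy⟩
          exact ⟨_, hy.1, hR.trans hxy hy.2⟩
  obtain ⟨F, _, _, _, G, s₀, hF, -, hinj, -⟩ := hgood (Module.finrank ℝ E + 1)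
  have := LinearMap.finrank_le_finrank_of_injective (f := (fderiv ℝ G s₀).toLinearMap) hinj
  omega

end Chow

/-! ### The Koszul formula, smooth Christoffel symbols and orthonormal frames -/

section Koszul

variable {m : ℕ} {M : Type*} [TopologicalSpace M] [ChartedSpace (EuclideanSpace ℝ (Fin m)) M]
  [IsManifold (𝓡 m) ∞ M]

lemma SmoothFieldOn.mdifferentiableAt {X : VField m M} {U : Set M} (hX : SmoothFieldOn X U)
    (hU : IsOpen U) {x : M} (hx : x ∈ U) :
    MDifferentiableAt (𝓡 m) (𝓡 m).tangent (fun y => (⟨y, X y⟩ : TangentBundle (𝓡 m) M)) x :=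
  ((hX x hx).contMDiffAt (hU.mem_nhds hx)).mdifferentiableAt (by simp)

/-- The derivative of a smooth function along a smooth vector field is smooth. -/
lemma SmoothFieldOn.contMDiffOn_mvfderiv {X : VField m M} {U : Set M} (hX : SmoothFieldOn X U)
    (hU : IsOpen U) {f : M → ℝ} (hf : ContMDiffOn (𝓡 m) 𝓘(ℝ, ℝ) ∞ f U) :
    ContMDiffOn (𝓡 m) 𝓘(ℝ, ℝ) ∞ (fun x => mvfderiv (𝓡 m) f x (X x)) U := by
  have h1 := (hf.contMDiffOn_tangentMapWithin (m := ∞) (by simp) hU.uniqueMDiffOn).comp hX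
    (fun x hx => hx)
  have h2 := (contMDiff_snd_tangentBundle_modelSpace ℝ 𝓘(ℝ, ℝ) (n := ∞)).comp_contMDiffOn h1
  refine h2.congr fun x hx => ?_
  change mfderiv (𝓡 m) 𝓘(ℝ, ℝ) f x (X x) = mfderivWithin (𝓡 m) 𝓘(ℝ, ℝ) f U x (X x)
  rw [mfderivWithin_of_isOpen hU hx]

lemma SmoothFieldOn.mlieBracket {X Y : VField m M} {U : Set M} (hU : IsOpen U)
    (hX : SmoothFieldOn X U) (hY : SmoothFieldOn Y U) :
    SmoothFieldOn (VectorField.mlieBracket (𝓡 m) X Y) U := by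
  have : IsManifold (𝓡 m) (((⊤ : ℕ∞) : WithTop ℕ∞) + 1) M :=
    inferInstanceAs (IsManifold (𝓡 m) ∞ M)
  have : IsManifold (𝓡 m) (minSmoothness ℝ 2) M := by
    rw [minSmoothness_of_isRCLikeNormedField]; infer_instance
  intro x hx
  exact (ContMDiffAt.mlieBracket_vectorField (m := ⊤) (n := ⊤)
    ((hX x hx).contMDiffAt (hU.mem_nhds hx)) ((hY x hx).contMDiffAt (hU.mem_nhds hx))
    (by simp)).contMDiffWithinAt

variable [RiemannianBundle (fun x : M => TangentSpace (𝓡 m) x)]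
  [IsContMDiffRiemannianBundle (𝓡 m) ∞ (EuclideanSpace ℝ (Fin m))
      (fun x : M => TangentSpace (𝓡 m) x)]

lemma SmoothFieldOn.inner {X Y : VField m M} {U : Set M} (hX : SmoothFieldOn X U)
    (hY : SmoothFieldOn Y U) :
    ContMDiffOn (𝓡 m) 𝓘(ℝ, ℝ) ∞ (fun x => inner ℝ (X x) (Y x)) U :=
  ContMDiffOn.inner_bundle hX hY

lemma mdifferentiableAt_inner {X Y : VField m M} {x : M}
    (hX : MDifferentiableAt (𝓡 m) (𝓡 m).tangent (fun y => (⟨y, X y⟩ : TangentBundle (𝓡 m) M)) x)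
    (hY : MDifferentiableAt (𝓡 m) (𝓡 m).tangent
      (fun y => (⟨y, Y y⟩ : TangentBundle (𝓡 m) M)) x) :
    MDifferentiableAt (𝓡 m) 𝓘(ℝ, ℝ) (fun y => inner ℝ (X y) (Y y)) x := by
  have : IsContMDiffRiemannianBundle (𝓡 m) 1 (EuclideanSpace ℝ (Fin m))
      (fun x : M => TangentSpace (𝓡 m) x) :=
    IsContMDiffRiemannianBundle.of_le (n := ∞) (by simp)
  exact MDifferentiableAt.inner_bundle hX hY

lemma contMDiffOn_koszul {X Y Z : VField m M} {U : Set M} (hU : IsOpen U)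
    (hX : SmoothFieldOn X U) (hY : SmoothFieldOn Y U) (hZ : SmoothFieldOn Z U) :
    ContMDiffOn (𝓡 m) 𝓘(ℝ, ℝ) ∞ (koszul X Y Z) U := by
  have h1 := hX.contMDiffOn_mvfderiv hU (hY.inner hZ)
  have h2 := hY.contMDiffOn_mvfderiv hU (hX.inner hZ)
  have h3 := hZ.contMDiffOn_mvfderiv hU (hX.inner hY)
  have h4 := (hX.mlieBracket hU hY).inner hZ
  have h5 := (hX.mlieBracket hU hZ).inner hY
  have h6 := (hY.mlieBracket hU hZ).inner hX
  exact contMDiffOn_const.mul (((((h1.add h2).sub h3).add h4).sub h5).sub h6)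

/-- The Koszul expression is tensorial in its last argument. -/
lemma tensorialAt_koszul {X Y : VField m M} {x : M}
    (hX : MDifferentiableAt (𝓡 m) (𝓡 m).tangent (fun y => (⟨y, X y⟩ : TangentBundle (𝓡 m) M)) x)
    (hY : MDifferentiableAt (𝓡 m) (𝓡 m).tangent
      (fun y => (⟨y, Y y⟩ : TangentBundle (𝓡 m) M)) x) :
    TensorialAt (𝓡 m) (EuclideanSpace ℝ (Fin m)) (fun Z : VField m M => koszul X Y Z x) x where
  smul {f Z} hf hZ := by
    have e1 : (fun y => inner ℝ (Y y) ((f • Z) y)) = fun y => f y * inner ℝ (Y y) (Z y) := by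
      funext y
      exact real_inner_smul_right _ _ _
    have e2 : (fun y => inner ℝ (X y) ((f • Z) y)) = fun y => f y * inner ℝ (X y) (Z y) := by
      funext y
      exact real_inner_smul_right _ _ _
    simp only [koszul]
    rw [e1, e2, mvfderiv_fun_mul hf (mdifferentiableAt_inner hY hZ), mvfderiv_fun_mul hf (mdifferentiableAt_inner hX hZ),
      VectorField.mlieBracket_smul_right hf hZ, VectorField.mlieBracket_smul_right hf hZ]
    have e3 : (f • Z) x = f x • Z x := rfl
    simp only [e3, inner_add_left, inner_smul_left, inner_smul_right, map_smul, smul_eq_mul,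
      add_apply, smul_apply, RCLike.conj_to_real]
    rw [real_inner_comm (Y x) (Z x), real_inner_comm (X x) (Z x)]
    ring
  add {Z Z'} hZ hZ' := by
    have e1 : (fun y => inner ℝ (Y y) ((Z + Z') y))
        = fun y => inner ℝ (Y y) (Z y) + inner ℝ (Y y) (Z' y) := by
      funext y
      exact inner_add_right _ _ _
    have e2 : (fun y => inner ℝ (X y) ((Z + Z') y))
        = fun y => inner ℝ (X y) (Z y) + inner ℝ (X y) (Z' y) := by
      funext y
      exact inner_add_right _ _ _
    simp only [koszul]
    rw [e1, e2, mvfderiv_fun_add (mdifferentiableAt_inner hY hZ) (mdifferentiableAt_inner hY hZ'),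
      mvfderiv_fun_add (mdifferentiableAt_inner hX hZ) (mdifferentiableAt_inner hX hZ'),
      VectorField.mlieBracket_add_right hZ hZ', VectorField.mlieBracket_add_right hZ hZ']
    have e3 : (Z + Z') x = Z x + Z' x := rfl
    simp only [e3, inner_add_left, inner_add_right, map_add, add_apply]
    ring

/-- The characteristic property of the Levi-Civita connection: `g(∇_X Y, Z)` is given by the
Koszul formula. -/
lemma inner_leviCivita {X Y Z : VField m M} {x : M}
    (hX : MDifferentiableAt (𝓡 m) (𝓡 m).tangent (fun y => (⟨y, X y⟩ : TangentBundle (𝓡 m) M)) x)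
    (hY : MDifferentiableAt (𝓡 m) (𝓡 m).tangent (fun y => (⟨y, Y y⟩ : TangentBundle (𝓡 m) M)) x)
    (hZ : MDifferentiableAt (𝓡 m) (𝓡 m).tangent
      (fun y => (⟨y, Z y⟩ : TangentBundle (𝓡 m) M)) x) :
    inner ℝ (leviCivita X Y x) (Z x) = koszul X Y Z x := by
  have hT := tensorialAt_koszul hX hY
  rw [← TensorialAt.mkHom_apply hT hZ]
  have hsum := (stdOrthonormalBasis ℝ (TangentSpace (𝓡 m) x)).sum_repr' (Z x)
  conv_rhs => rw [← hsum, map_sum]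
  rw [leviCivita, sum_inner]
  refine Finset.sum_congr rfl fun a _ => ?_
  rw [map_smul, TensorialAt.mkHom_apply_eq_extend, real_inner_smul_left, smul_eq_mul, mul_comm]

variable {k : ℕ} (S : Distribution m k M)

/-- The projection is self-adjoint and fixes `X r`. This removes both the projection and the
pointwise choice of basis in `leviCivita`, and leaves an expression that is visibly smooth in `x`.
-/
lemma Distribution.christoffel_eq_koszul {U : Set M} {X : Fin k → VField m M}
    (hX : S.IsOrthonormalFrameOn U X) {x : M} (hx : x ∈ U) (i j r : Fin k) :
    S.christoffel X i j r x = koszul (X i) (X j) (X r) x := by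
  have hd := fun i => (hX.smooth i).mdifferentiableAt hX.isOpen hx
  rw [← inner_leviCivita (hd i) (hd j) (hd r), Distribution.christoffel,
    Distribution.horizontalConnection, Submodule.inner_starProjection_left_eq_right,
    Submodule.starProjection_eq_self_iff.2 (hX.mem r x hx)]

lemma Distribution.contMDiffOn_christoffel {U : Set M} {X : Fin k → VField m M}
    (hX : S.IsOrthonormalFrameOn U X) (i j r : Fin k) :
    ContMDiffOn (𝓡 m) 𝓘(ℝ, ℝ) ∞ (S.christoffel X i j r) U :=
  (contMDiffOn_koszul hX.isOpen (hX.smooth i) (hX.smooth j) (hX.smooth r)).congr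
    fun _ hx => S.christoffel_eq_koszul hX hx i j r

/-- Near every point a distribution has a smooth orthonormal frame. -/
theorem Distribution.exists_orthonormalFrame (p : M) :
    ∃ (U : Set M) (X : Fin k → VField m M), S.IsOrthonormalFrameOn U X ∧ p ∈ U ∧
      ∀ x ∈ U, Submodule.span ℝ (range fun i => X i x) = S.at' x := by
  obtain ⟨U, hU, hp, Y, hY, hspan⟩ := S.exists_frame p
  -- `k` vectors spanning a space of dimension `k` are independent, so no denominator of
  -- Gram-Schmidt vanishes.
  have hli : ∀ x ∈ U, LinearIndependent ℝ (fun i => Y i x) := by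
    intro x hx
    rw [linearIndependent_iff_card_eq_finrank_span, Set.finrank, hspan x hx, S.finrank_eq x,
      Fintype.card_fin]
  have hgs : ∀ i, SmoothFieldOn
      (fun x => InnerProductSpace.gramSchmidt ℝ (fun i => Y i x) i) U := by
    intro i
    induction i using WellFoundedLT.induction with
    | ind i ih =>
      have hterm : ∀ j ∈ Finset.Iio i, SmoothFieldOn (fun x =>
          (inner ℝ (InnerProductSpace.gramSchmidt ℝ (fun i => Y i x) j) (Y i x) /
            inner ℝ (InnerProductSpace.gramSchmidt ℝ (fun i => Y i x) j)
              (InnerProductSpace.gramSchmidt ℝ (fun i => Y i x) j)) •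
            InnerProductSpace.gramSchmidt ℝ (fun i => Y i x) j) U := by
        intro j hj
        have hj' := ih j (Finset.mem_Iio.1 hj)
        refine ContMDiffOn.smul_section ?_ hj'
        refine (hj'.inner (hY i)).div₀ (hj'.inner hj') fun x hx => ?_
        exact inner_self_ne_zero.2 (InnerProductSpace.gramSchmidt_ne_zero j (hli x hx))
      have h := ContMDiffOn.sub_section (hY i) (ContMDiffOn.sum_section hterm)
      refine h.congr fun x hx => ?_
      congr 1
      beta_reduce
      rw [InnerProductSpace.gramSchmidt_def]
      simp only [Pi.sub_apply, Submodule.starProjection_singleton, real_inner_self_eq_norm_sq]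
      rfl
  refine ⟨U, fun i x => InnerProductSpace.gramSchmidtNormed ℝ (fun i => Y i x) i,
    ⟨hU, fun i => ?_, fun i x hx => ?_, fun x hx => ?_⟩, hp, fun x hx => ?_⟩
  · refine ContMDiffOn.smul_section (f := fun x =>
      (‖InnerProductSpace.gramSchmidt ℝ (fun i => Y i x) i‖)⁻¹) ?_ (hgs i)
    have h1 : ContMDiffOn (𝓡 m) 𝓘(ℝ, ℝ) ∞
        (fun x => ‖InnerProductSpace.gramSchmidt ℝ (fun i => Y i x) i‖) U := by
      have h2 := (hgs i).inner (hgs i)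
      intro x hx
      have h3 : ContDiffAt ℝ ∞ Real.sqrt
          (inner ℝ (InnerProductSpace.gramSchmidt ℝ (fun i => Y i x) i)
            (InnerProductSpace.gramSchmidt ℝ (fun i => Y i x) i)) :=
        Real.contDiffAt_sqrt (inner_self_ne_zero.2
          (InnerProductSpace.gramSchmidt_ne_zero i (hli x hx)))
      refine (h3.contMDiffAt.comp_contMDiffWithinAt x (h2 x hx)).congr (fun y _ => ?_) ?_
      · exact norm_eq_sqrt_real_inner _
      · exact norm_eq_sqrt_real_inner _
    exact h1.inv₀ fun x hx => norm_ne_zero_iff.2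
      (InnerProductSpace.gramSchmidt_ne_zero i (hli x hx))
  · rw [← hspan x hx, ← InnerProductSpace.span_gramSchmidt,
      ← InnerProductSpace.span_gramSchmidtNormed_range]
    exact Submodule.subset_span (mem_range_self i)
  · exact InnerProductSpace.gramSchmidtNormed_orthonormal (hli x hx)
  · rw [InnerProductSpace.span_gramSchmidtNormed_range, InnerProductSpace.span_gramSchmidt,
      hspan x hx]

end Koszul

/-! ### Vector fields and velocities in a chart -/

section ChartField

variable {m : ℕ} {M : Type*} [TopologicalSpace M] [ChartedSpace (EuclideanSpace ℝ (Fin m)) M]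

/-- The expression of a vector field in the chart at `p`. -/
def chartField (p : M) (Z : VField m M) : EuclideanSpace ℝ (Fin m) → EuclideanSpace ℝ (Fin m) :=
  VectorField.mpullback 𝓘(ℝ, EuclideanSpace ℝ (Fin m)) (𝓡 m) (extChartAt (𝓡 m) p).symm Z

/-- The derivative of the inverse of the chart at `p`. -/
def chartDeriv (p : M) (y : EuclideanSpace ℝ (Fin m)) :
    EuclideanSpace ℝ (Fin m) →L[ℝ] TangentSpace (𝓡 m) ((extChartAt (𝓡 m) p).symm y) :=
  mfderiv 𝓘(ℝ, EuclideanSpace ℝ (Fin m)) (𝓡 m) (extChartAt (𝓡 m) p).symm y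

lemma chartField_apply (p : M) (Z : VField m M) (y : EuclideanSpace ℝ (Fin m)) :
    chartField p Z y = (chartDeriv p y).inverse (Z ((extChartAt (𝓡 m) p).symm y)) := rfl

lemma isOpen_chartDomain (p : M) {U : Set M} (hU : IsOpen U) :
    IsOpen ((extChartAt (𝓡 m) p).target ∩ (extChartAt (𝓡 m) p).symm ⁻¹' U) :=
  (continuousOn_extChartAt_symm p).isOpen_inter_preimage (isOpen_extChartAt_target p) hU

variable [IsManifold (𝓡 m) ∞ M]

lemma contMDiffAt_extChartAt_symm {p : M} {y : EuclideanSpace ℝ (Fin m)}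
    (hy : y ∈ (extChartAt (𝓡 m) p).target) :
    ContMDiffAt 𝓘(ℝ, EuclideanSpace ℝ (Fin m)) (𝓡 m) ∞ (extChartAt (𝓡 m) p).symm y :=
  (contMDiffOn_extChartAt_symm p y hy).contMDiffAt ((isOpen_extChartAt_target p).mem_nhds hy)

lemma chartDeriv_isInvertible {p : M} {y : EuclideanSpace ℝ (Fin m)}
    (hy : y ∈ (extChartAt (𝓡 m) p).target) : (chartDeriv p y).IsInvertible := by
  have : IsManifold (𝓡 m) 1 M := IsManifold.of_le (n := ∞) (by simp)
  have h := isInvertible_mfderivWithin_extChartAt_symm (I := 𝓡 m) hy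
  rw [ModelWithCorners.range_eq_univ, mfderivWithin_univ] at h
  exact h

lemma chartDeriv_chartField {p : M} {y : EuclideanSpace ℝ (Fin m)}
    (hy : y ∈ (extChartAt (𝓡 m) p).target) (Z : VField m M) :
    chartDeriv p y (chartField p Z y) = Z ((extChartAt (𝓡 m) p).symm y) := by
  rw [chartField_apply]
  obtain ⟨e, he⟩ := chartDeriv_isInvertible hy
  rw [← he, ContinuousLinearMap.inverse_equiv]
  exact e.apply_symm_apply _

lemma contDiffOn_chartField (p : M) {Z : VField m M} {U : Set M} (hU : IsOpen U)
    (hZ : SmoothFieldOn Z U) :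
    ContDiffOn ℝ ∞ (chartField p Z)
      ((extChartAt (𝓡 m) p).target ∩ (extChartAt (𝓡 m) p).symm ⁻¹' U) := by
  rintro y ⟨hy, hyU⟩
  have : IsManifold (𝓡 m) ((∞ : WithTop ℕ∞) + 1) M := inferInstanceAs (IsManifold (𝓡 m) ∞ M)
  have h := ContMDiffAt.mpullback_vectorField_preimage (m := ∞) (n := ∞)
    ((hZ _ hyU).contMDiffAt (hU.mem_nhds hyU)) (contMDiffAt_extChartAt_symm hy)
    (chartDeriv_isInvertible hy) (by simp)
  exact (contMDiffAt_vectorSpace_iff_contDiffAt.1 h).contDiffWithinAt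

lemma chartField_mlieBracket {p : M} {y : EuclideanSpace ℝ (Fin m)}
    (hy : y ∈ (extChartAt (𝓡 m) p).target) {Z Z' : VField m M} (hZ : SmoothFieldOn Z univ)
    (hZ' : SmoothFieldOn Z' univ) :
    chartField p (VectorField.mlieBracket (𝓡 m) Z Z') y
      = VectorField.lieBracket ℝ (chartField p Z) (chartField p Z') y := by
  have : IsManifold (𝓡 m) (minSmoothness ℝ 2) M := by
    rw [minSmoothness_of_isRCLikeNormedField]; infer_instance
  have h := VectorField.mpullback_mlieBracket (n := ∞)
    (hZ.mdifferentiableAt isOpen_univ (mem_univ ((extChartAt (𝓡 m) p).symm y)))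
    (hZ'.mdifferentiableAt isOpen_univ (mem_univ ((extChartAt (𝓡 m) p).symm y)))
    (contMDiffAt_extChartAt_symm hy)
    (by rw [minSmoothness_of_isRCLikeNormedField]; exact WithTop.coe_le_coe.2 le_top)
  refine h.trans ?_
  have e := congrFun (VectorField.mlieBracketWithin_eq_lieBracketWithin (𝕜 := ℝ)
    (V := chartField p Z) (W := chartField p Z') (s := univ)) y
  rw [VectorField.lieBracketWithin_univ] at e
  exact e

lemma velocity_extChartAt_symm_comp {p : M} {c : ℝ → EuclideanSpace ℝ (Fin m)}
    {c' : EuclideanSpace ℝ (Fin m)} {t : ℝ} (hc : HasDerivAt c c' t)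
    (ht : c t ∈ (extChartAt (𝓡 m) p).target) :
    velocity (fun s => (extChartAt (𝓡 m) p).symm (c s)) t = chartDeriv p (c t) c' := by
  have h1 := ((contMDiffAt_extChartAt_symm ht).mdifferentiableAt (by simp)).hasMFDerivAt.comp t
    hc.hasFDerivAt.hasMFDerivAt
  have h2 := h1.mfderiv
  change mfderiv 𝓘(ℝ, ℝ) (𝓡 m) ((extChartAt (𝓡 m) p).symm ∘ c) t (1 : ℝ) = _
  rw [h2]
  change chartDeriv p (c t) ((1 : ℝ) • c') = _
  rw [one_smul]

end ChartField

/-! ### The geodesic equation as a first-order system -/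

section Geodesics

variable {m : ℕ} {M : Type*} [TopologicalSpace M] [ChartedSpace (EuclideanSpace ℝ (Fin m)) M]
  [IsManifold (𝓡 m) ∞ M] [RiemannianBundle (fun x : M => TangentSpace (𝓡 m) x)]
  {k : ℕ} (S : Distribution m k M)

namespace Distribution

/-- The nonholonomic geodesic field in the chart at `p`, on the space of pairs of a point and the
coordinates of a horizontal velocity in the frame `X`. -/
def geodesicField (p : M) (X : Fin k → VField m M)
    (z : EuclideanSpace ℝ (Fin m) × (Fin k → ℝ)) : EuclideanSpace ℝ (Fin m) × (Fin k → ℝ) :=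
  (∑ i, z.2 i • chartField p (X i) z.1, fun r =>
    -∑ i, ∑ j, z.2 i * z.2 j * S.christoffel X i j r ((extChartAt (𝓡 m) p).symm z.1))

/-- The part of the phase space on which the geodesic field is defined. -/
def phaseDomain (m k : ℕ) {M : Type*} [TopologicalSpace M]
    [ChartedSpace (EuclideanSpace ℝ (Fin m)) M] (p : M) (U : Set M) :
    Set (EuclideanSpace ℝ (Fin m) × (Fin k → ℝ)) :=
  ((extChartAt (𝓡 m) p).target ∩ (extChartAt (𝓡 m) p).symm ⁻¹' U) ×ˢ univ

lemma contDiffOn_geodesicField [IsContMDiffRiemannianBundle (𝓡 m) ∞ (EuclideanSpace ℝ (Fin m))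
      (fun x : M => TangentSpace (𝓡 m) x)] (p : M) {U : Set M} {X : Fin k → VField m M}
    (hX : S.IsOrthonormalFrameOn U X) :
    ContDiffOn ℝ ∞ (S.geodesicField p X) (phaseDomain m k p U) := by
  have hcoord : ∀ i : Fin k, ContDiff ℝ ∞
      (fun z : EuclideanSpace ℝ (Fin m) × (Fin k → ℝ) => z.2 i) := fun i =>
    (contDiff_apply ℝ ℝ i).comp contDiff_snd
  have hfst : MapsTo (Prod.fst : EuclideanSpace ℝ (Fin m) × (Fin k → ℝ) → _) (phaseDomain m k p U)
      ((extChartAt (𝓡 m) p).target ∩ (extChartAt (𝓡 m) p).symm ⁻¹' U) := fun z hz => hz.1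
  refine ContDiffOn.prodMk ?_ (contDiffOn_pi.2 fun r => ContDiffOn.neg ?_)
  · refine ContDiffOn.sum fun i _ => (hcoord i).contDiffOn.smul ?_
    exact (contDiffOn_chartField p hX.isOpen (hX.smooth i)).comp contDiff_fst.contDiffOn hfst
  · refine ContDiffOn.sum fun i _ => ContDiffOn.sum fun j _ =>
      ((hcoord i).contDiffOn.mul (hcoord j).contDiffOn).mul ?_
    have h1 : ContDiffOn ℝ ∞ (fun y => S.christoffel X i j r ((extChartAt (𝓡 m) p).symm y))
        ((extChartAt (𝓡 m) p).target ∩ (extChartAt (𝓡 m) p).symm ⁻¹' U) := by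
      rw [← contMDiffOn_iff_contDiffOn]
      exact (S.contMDiffOn_christoffel hX i j r).comp
        ((contMDiffOn_extChartAt_symm p).mono inter_subset_left) fun y hy => hy.2
    exact h1.comp contDiff_fst.contDiffOn hfst

/-- The solutions of the geodesic equation are nonholonomic geodesics. -/
theorem isNonholonomicGeodesicOn_of_hasDerivWithinAt
    [IsContMDiffRiemannianBundle (𝓡 m) ∞ (EuclideanSpace ℝ (Fin m))
      (fun x : M => TangentSpace (𝓡 m) x)] {p : M} {U : Set M} {X : Fin k → VField m M}
    (hX : S.IsOrthonormalFrameOn U X) {c : ℝ → EuclideanSpace ℝ (Fin m) × (Fin k → ℝ)}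
    {a b ε : ℝ} (hmem : MapsTo c (Icc a b) (phaseDomain m k p U))
    (hc : ∀ t ∈ Icc a b, HasDerivWithinAt c (ε • S.geodesicField p X (c t)) (Icc a b) t) :
    S.IsNonholonomicGeodesicOn (fun t => (extChartAt (𝓡 m) p).symm (c t).1) a b := by
  set γ : ℝ → M := fun t => (extChartAt (𝓡 m) p).symm (c t).1 with hγ
  have hcd : ∀ t ∈ Ioo a b, HasDerivAt c (ε • S.geodesicField p X (c t)) t := fun t ht =>
    (hc t (Ioo_subset_Icc_self ht)).hasDerivAt (Icc_mem_nhds ht.1 ht.2)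
  have hU : ∀ t ∈ Icc a b, γ t ∈ U := fun t ht => (hmem ht).1.2
  have hvel : ∀ t ∈ Ioo a b, velocity γ t = ∑ i, (ε * (c t).2 i) • X i (γ t) := by
    intro t ht
    have htar := (hmem (Ioo_subset_Icc_self ht)).1.1
    have h1 : HasDerivAt (fun s => (c s).1) (ε • S.geodesicField p X (c t)).1 t :=
      (hcd t ht).fst
    rw [hγ, velocity_extChartAt_symm_comp h1 htar, Prod.smul_fst, geodesicField, map_smul,
      map_sum, Finset.smul_sum]
    refine Finset.sum_congr rfl fun i _ => ?_
    rw [map_smul, chartDeriv_chartField htar, smul_smul]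
  refine ⟨?_, fun t ht => ?_, fun t ht => ?_⟩
  · have h1 : ContDiffOn ℝ ((⊤ : ℕ∞) : WithTop ℕ∞) c (Icc a b) := by
      refine ODE.contDiffOn_enat_Icc_of_hasDerivWithinAt (u := phaseDomain m k p U)
        (f := fun _ z => ε • S.geodesicField p X z) ?_ hc hmem
      have h2 : MapsTo Prod.snd (Icc a b ×ˢ phaseDomain m k p U) (phaseDomain m k p U) :=
        fun z hz => hz.2
      exact ((S.contDiffOn_geodesicField p hX).comp contDiff_snd.contDiffOn h2).const_smul ε
    have h2 : ContMDiffOn 𝓘(ℝ, ℝ) 𝓘(ℝ, EuclideanSpace ℝ (Fin m)) ∞ (fun t => (c t).1)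
        (Icc a b) := (contDiff_fst.comp_contDiffOn h1).contMDiffOn
    exact (contMDiffOn_extChartAt_symm p).comp h2 fun t ht => (hmem ht).1.1
  · rw [hvel t ht]
    exact Submodule.sum_mem _ fun i _ => Submodule.smul_mem _ _
      (hX.mem i _ (hU t (Ioo_subset_Icc_self ht)))
  · refine ⟨U, X, hX, hU t (Ioo_subset_Icc_self ht), ?_⟩
    have hinner : ∀ s ∈ Ioo a b, ∀ r, inner ℝ (velocity γ s) (X r (γ s)) = ε * (c s).2 r := by
      intro s hs r
      rw [hvel s hs]
      exact (hX.orthonormal _ (hU s (Ioo_subset_Icc_self hs))).inner_left_fintype _ r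
    refine Finset.sum_eq_zero fun r _ => ?_
    -- The velocity has frame coordinates `ε * u`, so both terms of the acceleration carry `ε ^ 2`
    -- and cancel by the equation for `u'`.
    have hderiv : deriv (fun s => inner ℝ (velocity γ s) (X r (γ s))) t
        = ε * (ε * (S.geodesicField p X (c t)).2 r) := by
      have h1 : HasDerivAt (fun s => ε * (c s).2 r)
          (ε * (ε • S.geodesicField p X (c t)).2 r) t :=
        (hasDerivAt_pi.1 (hcd t ht).snd r).const_mul ε
      refine (h1.congr_of_eventuallyEq ?_).deriv
      filter_upwards [isOpen_Ioo.mem_nhds ht] with s hs using hinner s hs r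
    simp only [hinner t ht]
    rw [hderiv, geodesicField]
    convert zero_smul ℝ _
    simp only [mul_neg, Finset.mul_sum]
    rw [neg_add_eq_zero]
    refine Finset.sum_congr rfl fun i _ => Finset.sum_congr rfl fun j _ => ?_
    ring

end Distribution

end Geodesics

/-! ### Velocity under change of germ and of parameter -/

section Curves

variable {m : ℕ} {M : Type*} [TopologicalSpace M] [ChartedSpace (EuclideanSpace ℝ (Fin m)) M]

/-- A property of the velocity depends only on the germ of the curve. -/
lemma velocity_congr {γ γ' : ℝ → M} {t : ℝ} (h : γ' =ᶠ[𝓝 t] γ)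
    (P : (x : M) → TangentSpace (𝓡 m) x → Prop) (hP : P (γ t) (velocity γ t)) :
    P (γ' t) (velocity γ' t) := by
  have hv : (velocity γ' t : EuclideanSpace ℝ (Fin m)) = velocity γ t :=
    congrArg (fun L : ℝ →L[ℝ] EuclideanSpace ℝ (Fin m) => L 1)
      (h.mfderiv_eq (I := 𝓘(ℝ, ℝ)) (I' := 𝓡 m))
  -- The velocities live in tangent spaces at different expressions for the point; reading them in
  -- the model space allows substitution.
  have key : ∀ (x y : M) (v w : EuclideanSpace ℝ (Fin m)), y = x → w = v →
      P x v → P y w := by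
    rintro x _ v _ rfl rfl h
    exact h
  exact key _ _ _ _ h.self_of_nhds hv hP

lemma velocity_comp_affine {γ : ℝ → M} {σ d t : ℝ}
    (hγ : MDifferentiableAt 𝓘(ℝ, ℝ) (𝓡 m) γ (σ * t + d)) :
    velocity (m := m) (fun s => γ (σ * s + d)) t = σ • velocity γ (σ * t + d) := by
  have hf : HasDerivAt (fun s : ℝ => σ * s + d) σ t := by
    simpa using ((hasDerivAt_id t).const_mul σ).add_const d
  have h1 := (hγ.hasMFDerivAt.comp (f := fun s : ℝ => σ * s + d) t
    hf.hasFDerivAt.hasMFDerivAt).mfderiv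
  change mfderiv 𝓘(ℝ, ℝ) (𝓡 m) (γ ∘ fun s : ℝ => σ * s + d) t (1 : ℝ) = _
  rw [h1]
  have h2 : ∀ A : ℝ →L[ℝ] EuclideanSpace ℝ (Fin m), A ((1 : ℝ) • σ) = σ • A 1 := fun A => by
    rw [← map_smul, smul_eq_mul, smul_eq_mul, mul_comm]
  exact h2 (mfderiv 𝓘(ℝ, ℝ) (𝓡 m) γ (σ * t + d))

end Curves

/-! ### Invariance properties of nonholonomic geodesics -/

section Geodesics

variable {m : ℕ} {M : Type*} [TopologicalSpace M] [ChartedSpace (EuclideanSpace ℝ (Fin m)) M]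
  [IsManifold (𝓡 m) ∞ M] [RiemannianBundle (fun x : M => TangentSpace (𝓡 m) x)]
  {k : ℕ} (S : Distribution m k M)

namespace Distribution

/-- The components of the horizontal acceleration of a curve in a frame. -/
def acceleration (X : Fin k → VField m M) (γ : ℝ → M) (t : ℝ) (r : Fin k) : ℝ :=
  deriv (fun s => inner ℝ (velocity γ s) (X r (γ s))) t
    + ∑ i, ∑ j, inner ℝ (velocity γ t) (X i (γ t)) * inner ℝ (velocity γ t) (X j (γ t)) *
        S.christoffel X i j r (γ t)

lemma covDerivAlong_velocity_eq_zero_iff {U : Set M} {X : Fin k → VField m M}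
    (hX : S.IsOrthonormalFrameOn U X) {γ : ℝ → M} {t : ℝ} (ht : γ t ∈ U) :
    S.covDerivAlong X γ (velocity γ) t = 0 ↔ ∀ r, S.acceleration X γ t r = 0 := by
  refine ⟨fun h r => ?_, fun h => Finset.sum_eq_zero fun r _ => ?_⟩
  · have h' : ∑ r, S.acceleration X γ t r • X r (γ t) = 0 := h
    have h1 := (hX.orthonormal _ ht).inner_left_fintype (S.acceleration X γ t) r
    rw [h', inner_zero_left] at h1
    exact h1.symm
  · have := h r
    rw [acceleration] at this
    rw [this, zero_smul]

variable {S}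

lemma IsNonholonomicGeodesicOn.mdifferentiableAt {γ : ℝ → M} {a b : ℝ}
    (h : S.IsNonholonomicGeodesicOn γ a b) {t : ℝ} (ht : t ∈ Ioo a b) :
    MDifferentiableAt 𝓘(ℝ, ℝ) (𝓡 m) γ t :=
  ((h.smooth t (Ioo_subset_Icc_self ht)).contMDiffAt
    (Icc_mem_nhds ht.1 ht.2)).mdifferentiableAt (by simp)

lemma IsNonholonomicGeodesicOn.congr {γ γ' : ℝ → M} {a b : ℝ}
    (h : S.IsNonholonomicGeodesicOn γ a b) (heq : EqOn γ' γ (Icc a b)) :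
    S.IsNonholonomicGeodesicOn γ' a b := by
  have hgerm : ∀ t ∈ Ioo a b, γ' =ᶠ[𝓝 t] γ := fun t ht => by
    filter_upwards [Icc_mem_nhds ht.1 ht.2] with s hs using heq hs
  refine ⟨h.smooth.congr heq, fun t ht => ?_, fun t ht => ?_⟩
  · exact velocity_congr (hgerm t ht) (fun x v => v ∈ S.at' x) (h.horizontal t ht)
  · obtain ⟨U, X, hX, hU, h0⟩ := h.geodesic t ht
    have hγ't : γ' t = γ t := heq (Ioo_subset_Icc_self ht)
    have hU' : γ' t ∈ U := hγ't ▸ hU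
    refine ⟨U, X, hX, hU', ?_⟩
    rw [S.covDerivAlong_velocity_eq_zero_iff hX hU] at h0
    rw [S.covDerivAlong_velocity_eq_zero_iff hX hU']
    intro r
    have hinner : ∀ s ∈ Ioo a b, ∀ i, inner ℝ (velocity γ' s) (X i (γ' s))
        = inner ℝ (velocity γ s) (X i (γ s)) := fun s hs i =>
      velocity_congr (hgerm s hs)
        (fun x v => inner ℝ v (X i x) = inner ℝ (velocity γ s) (X i (γ s))) rfl
    have hderiv : (fun s => inner ℝ (velocity γ' s) (X r (γ' s)))
        =ᶠ[𝓝 t] fun s => inner ℝ (velocity γ s) (X r (γ s)) := by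
      filter_upwards [isOpen_Ioo.mem_nhds ht] with s hs using hinner s hs r
    rw [← h0 r, acceleration, acceleration, hderiv.deriv_eq]
    simp only [hinner t ht, hγ't]

/-- Nonholonomic geodesics are preserved by affine reparametrizations. -/
lemma IsNonholonomicGeodesicOn.comp_affine {γ : ℝ → M} {a b : ℝ}
    (h : S.IsNonholonomicGeodesicOn γ a b) {σ d a' b' : ℝ}
    (hIcc : MapsTo (fun t => σ * t + d) (Icc a' b') (Icc a b))
    (hIoo : MapsTo (fun t => σ * t + d) (Ioo a' b') (Ioo a b)) :
    S.IsNonholonomicGeodesicOn (fun t => γ (σ * t + d)) a' b' := by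
  have haff : ContDiff ℝ ∞ (fun t : ℝ => σ * t + d) :=
    (contDiff_const.mul contDiff_id).add contDiff_const
  have hvel : ∀ t ∈ Ioo a' b', velocity (fun s => γ (σ * s + d)) t
      = σ • velocity γ (σ * t + d) := fun t ht =>
    velocity_comp_affine (h.mdifferentiableAt (hIoo ht))
  refine ⟨h.smooth.comp haff.contMDiff.contMDiffOn hIcc, fun t ht => ?_, fun t ht => ?_⟩
  · rw [hvel t ht]
    exact Submodule.smul_mem _ _ (h.horizontal _ (hIoo ht))
  · have ht' : σ * t + d ∈ Ioo a b := hIoo ht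
    obtain ⟨U, X, hX, hU, h0⟩ := h.geodesic _ ht'
    refine ⟨U, X, hX, hU, ?_⟩
    rw [S.covDerivAlong_velocity_eq_zero_iff hX hU] at h0
    refine (S.covDerivAlong_velocity_eq_zero_iff hX
      (γ := fun t => γ (σ * t + d)) (t := t) hU).2 fun r => ?_
    have hinner : ∀ s ∈ Ioo a' b', ∀ i,
        inner ℝ (velocity (fun s => γ (σ * s + d)) s) (X i (γ (σ * s + d)))
        = σ * inner ℝ (velocity γ (σ * s + d)) (X i (γ (σ * s + d))) := fun s hs i => by
      rw [hvel s hs, real_inner_smul_left]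
    have hderiv : (fun s => inner ℝ (velocity (fun s => γ (σ * s + d)) s) (X r (γ (σ * s + d))))
        =ᶠ[𝓝 t] fun s => σ * inner ℝ (velocity γ (σ * s + d)) (X r (γ (σ * s + d))) := by
      filter_upwards [isOpen_Ioo.mem_nhds ht] with s hs using hinner s hs r
    have hd2 : deriv (fun s => inner ℝ (velocity γ (σ * s + d)) (X r (γ (σ * s + d)))) t
        = σ * deriv (fun s => inner ℝ (velocity γ s) (X r (γ s))) (σ * t + d) := by
      rw [deriv_comp_mul_left σ (fun s => inner ℝ (velocity γ (s + d)) (X r (γ (s + d)))) t,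
        deriv_comp_add_const (fun s => inner ℝ (velocity γ s) (X r (γ s))) d, smul_eq_mul]
    have h1 := h0 r
    rw [acceleration] at h1
    rw [acceleration, hderiv.deriv_eq, deriv_const_mul_field, hd2]
    simp only [hinner t ht]
    -- The acceleration is multiplied by `σ ^ 2`, so `σ` may be negative or zero.
    have h2 : ∀ A B : ℝ, A + B = 0 → σ * (σ * A) + σ * σ * B = 0 := fun A B hAB => by
      linear_combination σ * σ * hAB
    rw [← h2 _ _ h1, Finset.mul_sum]
    congr 1
    refine Finset.sum_congr rfl fun i _ => ?_
    rw [Finset.mul_sum]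
    exact Finset.sum_congr rfl fun j _ => by ring

lemma isNonholonomicGeodesicOn_const [IsContMDiffRiemannianBundle (𝓡 m) ∞
      (EuclideanSpace ℝ (Fin m)) (fun x : M => TangentSpace (𝓡 m) x)]
    (S : Distribution m k M) (p : M) (a b : ℝ) :
    S.IsNonholonomicGeodesicOn (fun _ => p) a b := by
  have hvel : ∀ t, velocity (fun _ : ℝ => p) t = (0 : TangentSpace (𝓡 m) p) := fun t => by
    rw [velocity, mfderiv_const]
    rfl
  refine ⟨contMDiffOn_const, fun t _ => ?_, fun t _ => ?_⟩
  · rw [hvel]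
    exact Submodule.zero_mem _
  · obtain ⟨U, X, hX, hp, -⟩ := S.exists_orthonormalFrame p
    refine ⟨U, X, hX, hp, (S.covDerivAlong_velocity_eq_zero_iff hX hp).2 fun r => ?_⟩
    simp [acceleration, hvel]

end Distribution

end Geodesics

/-! ### Finiteness of length -/

section Length

variable {m : ℕ} {M : Type*} [TopologicalSpace M] [ChartedSpace (EuclideanSpace ℝ (Fin m)) M]
  [IsManifold (𝓡 m) ∞ M] [RiemannianBundle (fun x : M => TangentSpace (𝓡 m) x)]

/-- The speed is continuous on a compact interval, hence bounded. Derivatives are taken within `Icc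
a b`, since the curve is arbitrary outside. -/
lemma pathELength_ne_top_of_contMDiffOn [IsContMDiffRiemannianBundle (𝓡 m) ∞
      (EuclideanSpace ℝ (Fin m)) (fun x : M => TangentSpace (𝓡 m) x)]
    {γ : ℝ → M} {a b : ℝ} (hab : a < b) (hγ : ContMDiffOn 𝓘(ℝ, ℝ) (𝓡 m) ∞ γ (Icc a b)) :
    pathELength (𝓡 m) γ a b ≠ ⊤ := by
  have hU : UniqueMDiffOn 𝓘(ℝ, ℝ) (Icc a b) := (uniqueDiffOn_Icc hab).uniqueMDiffOn
  -- The tangent map of `γ` along the unit field of the line is the velocity as a smooth curve in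
  -- the tangent bundle.
  have hone : ContMDiff 𝓘(ℝ, ℝ) 𝓘(ℝ, ℝ).tangent ∞
      (fun t : ℝ => (⟨t, (1 : ℝ)⟩ : TangentBundle 𝓘(ℝ, ℝ) ℝ)) := by
    intro t
    exact contMDiffAt_vectorSpace_iff_contDiffAt.2 (contDiffAt_const (c := (1 : ℝ)))
  have h1 := (hγ.contMDiffOn_tangentMapWithin (m := ∞) (by simp) hU).comp
    hone.contMDiffOn (s := Icc a b) (fun t ht => ht)
  have h2 := (ContMDiffOn.inner_bundle (F := EuclideanSpace ℝ (Fin m))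
    (E := fun x : M => TangentSpace (𝓡 m) x) (IB := 𝓡 m) (n := ∞)
    (v := fun t => mfderivWithin 𝓘(ℝ, ℝ) (𝓡 m) γ (Icc a b) t (1 : ℝ))
    (w := fun t => mfderivWithin 𝓘(ℝ, ℝ) (𝓡 m) γ (Icc a b) t (1 : ℝ)) h1 h1).continuousOn
  obtain ⟨C, hC⟩ := isCompact_Icc.bddAbove_image h2
  rw [pathELength_eq_lintegral_mfderivWithin_Icc]
  refine ((MeasureTheory.setLIntegral_mono_ae' measurableSet_Icc
    (g := fun _ => ENNReal.ofReal (√C)) ?_).trans_lt ?_).ne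
  · refine MeasureTheory.ae_of_all _ fun t ht => ?_
    rw [← ofReal_norm, norm_eq_sqrt_real_inner]
    exact ENNReal.ofReal_le_ofReal (Real.sqrt_le_sqrt (hC (mem_image_of_mem _ ht)))
  · simp [ENNReal.mul_lt_top_iff]

end Length

/-! ### Chains of geodesics and the distance -/

section Chains

variable {m : ℕ} {M : Type*} [TopologicalSpace M] [ChartedSpace (EuclideanSpace ℝ (Fin m)) M]
  [IsManifold (𝓡 m) ∞ M] [RiemannianBundle (fun x : M => TangentSpace (𝓡 m) x)]
  {k : ℕ} (S : Distribution m k M)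

namespace Distribution

/-- `S.Chain ℓ p q`: the points `p` and `q` are joined by finitely many successive nonholonomic
geodesics of total length `ℓ`. -/
inductive Chain : ℝ≥0∞ → M → M → Prop
  | single {γ : ℝ → M} {a b : ℝ} (hab : a < b) (hγ : S.IsNonholonomicGeodesicOn γ a b) :
      Chain (pathELength (𝓡 m) γ a b) (γ a) (γ b)
  | snoc {ℓ : ℝ≥0∞} {p : M} {γ : ℝ → M} {a b : ℝ} (h : Chain ℓ p (γ a)) (hab : a < b)
      (hγ : S.IsNonholonomicGeodesicOn γ a b) :
      Chain (ℓ + pathELength (𝓡 m) γ a b) p (γ b)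

variable {S}

lemma Chain.trans {ℓ ℓ' : ℝ≥0∞} {p q r : M} (h : S.Chain ℓ p q) (h' : S.Chain ℓ' q r) :
    S.Chain (ℓ + ℓ') p r := by
  induction h' with
  | single hab hγ => exact h.snoc hab hγ
  | snoc _ hab hγ ih =>
    rw [← add_assoc]
    exact (ih h).snoc hab hγ

/-- Time reversal is the affine reparametrization with factor `-1`: it preserves geodesics and
length. -/
lemma Chain.symm {ℓ : ℝ≥0∞} {p q : M} (h : S.Chain ℓ p q) : S.Chain ℓ q p := by
  have hrev : ∀ {γ : ℝ → M} {a b : ℝ}, a < b → S.IsNonholonomicGeodesicOn γ a b →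
      S.Chain (pathELength (𝓡 m) γ a b) (γ b) (γ a) := by
    intro γ a b hab hγ
    have hγ' : S.IsNonholonomicGeodesicOn (fun t => γ (-1 * t + 0)) (-b) (-a) :=
      hγ.comp_affine (fun t ht => ⟨by linarith [ht.2], by linarith [ht.1]⟩)
        (fun t ht => ⟨by linarith [ht.2], by linarith [ht.1]⟩)
    have hlen := pathELength_comp_of_antitoneOn (I := 𝓡 m) (γ := γ)
      (f := fun t => -1 * t + 0) (a := -b) (b := -a) (by linarith)
      (fun s _ t _ hst => by simpa using hst)
      (((differentiable_id.const_mul (-1 : ℝ)).add_const 0).differentiableOn)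
      (by simpa using hγ.smooth.mdifferentiableOn (by simp))
    have h1 := Chain.single (by linarith) hγ'
    have h2 : pathELength (𝓡 m) (fun t => γ (-1 * t + 0)) (-b) (-a)
        = pathELength (𝓡 m) γ a b := by
      simpa [Function.comp_def] using hlen
    rw [h2] at h1
    simpa using h1
  induction h with
  | single hab hγ => exact hrev hab hγ
  | snoc _ hab hγ ih =>
    rw [add_comm]
    exact (hrev hab hγ).trans ih

lemma Chain.refl [IsContMDiffRiemannianBundle (𝓡 m) ∞ (EuclideanSpace ℝ (Fin m))
      (fun x : M => TangentSpace (𝓡 m) x)] (S : Distribution m k M) (p : M) :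
    S.Chain 0 p p := by
  have h := Chain.single zero_lt_one (isNonholonomicGeodesicOn_const S p 0 1)
  have h0 : pathELength (𝓡 m) (fun _ : ℝ => p) 0 1 = 0 := by
    rw [pathELength_eq_lintegral_mfderiv_Icc]
    simp [mfderiv_const]
  rwa [h0] at h

lemma Chain.ne_top [IsContMDiffRiemannianBundle (𝓡 m) ∞ (EuclideanSpace ℝ (Fin m))
      (fun x : M => TangentSpace (𝓡 m) x)] {ℓ : ℝ≥0∞} {p q : M} (h : S.Chain ℓ p q) :
    ℓ ≠ ⊤ := by
  induction h with
  | single hab hγ => exact pathELength_ne_top_of_contMDiffOn hab hγ.smooth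
  | snoc _ hab hγ ih =>
    exact ENNReal.add_ne_top.2 ⟨ih, pathELength_ne_top_of_contMDiffOn hab hγ.smooth⟩

lemma Chain.riemannianEDist_le {ℓ : ℝ≥0∞} {p q : M} (h : S.Chain ℓ p q) :
    riemannianEDist (𝓡 m) p q ≤ ℓ := by
  have hone : ∀ {γ : ℝ → M} {a b : ℝ}, a < b → S.IsNonholonomicGeodesicOn γ a b →
      riemannianEDist (𝓡 m) (γ a) (γ b) ≤ pathELength (𝓡 m) γ a b := fun hab hγ =>
    riemannianEDist_le_pathELength (hγ.smooth.of_le (by simp)) rfl rfl hab.le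
  induction h with
  | single hab hγ => exact hone hab hγ
  | snoc _ hab hγ ih =>
    exact (riemannianEDist_triangle (I := 𝓡 m)).trans (add_le_add ih (hone hab hγ))

lemma IsBrokenGeodesicOn.chain {γ : ℝ → M} {a b : ℝ} (h : S.IsBrokenGeodesicOn γ a b) :
    S.Chain (pathELength (𝓡 m) γ a b) (γ a) (γ b) := by
  obtain ⟨hab, -, n, t, rfl, rfl, ht⟩ := h
  -- A chain has at least one piece; `a < b` excludes the empty subdivision.
  have hn : 1 ≤ n := by
    rcases Nat.eq_zero_or_pos n with rfl | hn
    · exact absurd hab (lt_irrefl _)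
    · exact hn
  clear hab
  have key : ∀ n, 1 ≤ n → (∀ i < n, t i < t (i + 1) ∧
      S.IsNonholonomicGeodesicOn γ (t i) (t (i + 1))) →
      t 0 ≤ t n ∧ S.Chain (pathELength (𝓡 m) γ (t 0) (t n)) (γ (t 0)) (γ (t n)) := by
    intro n hn
    induction n, hn using Nat.le_induction with
    | base => exact fun h => ⟨(h 0 one_pos).1.le, Chain.single (h 0 one_pos).1 (h 0 one_pos).2⟩
    | succ n _ ih =>
      intro h
      obtain ⟨hle, hc⟩ := ih fun i hi => h i (hi.trans n.lt_succ_self)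
      obtain ⟨hlt, hg⟩ := h n n.lt_succ_self
      refine ⟨hle.trans hlt.le, ?_⟩
      rw [← pathELength_add hle hlt.le]
      exact hc.snoc hlt hg
  exact (key n hn ht).2

lemma IsNonholonomicGeodesicOn.isBrokenGeodesicOn {γ : ℝ → M} {a b : ℝ} (hab : a < b)
    (h : S.IsNonholonomicGeodesicOn γ a b) : S.IsBrokenGeodesicOn γ a b :=
  ⟨hab, h.smooth.continuousOn, 1, fun i => if i = 0 then a else b, by simp, by simp,
    fun i hi => by
      obtain rfl : i = 0 := by omega
      simpa using ⟨hab, h⟩⟩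

/-- A broken geodesic can be prolonged by a nonholonomic geodesic. -/
lemma IsBrokenGeodesicOn.exists_snoc {γ γ' : ℝ → M} {a b c d : ℝ}
    (h : S.IsBrokenGeodesicOn γ a b) (hcd : c < d) (h' : S.IsNonholonomicGeodesicOn γ' c d)
    (hγ : γ b = γ' c) :
    ∃ (η : ℝ → M) (e : ℝ), S.IsBrokenGeodesicOn η a e ∧ η a = γ a ∧ η e = γ' d ∧
      pathELength (𝓡 m) η a e = pathELength (𝓡 m) γ a b + pathELength (𝓡 m) γ' c d := by
  obtain ⟨hab, hcont, n, t, ht0, htn, ht⟩ := h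
  set e := b + (d - c) with he
  have hbe : b < e := by linarith
  -- The new piece is shifted in time so as to start at `b`.
  let δ : ℝ → M := fun s => γ' (1 * s + (c - b))
  have hδ : S.IsNonholonomicGeodesicOn δ b e :=
    h'.comp_affine (fun s hs => ⟨by linarith [hs.1], by linarith [hs.2]⟩)
      (fun s hs => ⟨by linarith [hs.1], by linarith [hs.2]⟩)
  have hδb : δ b = γ b := by
    rw [hγ]
    exact congrArg γ' (by ring)
  have hδe : δ e = γ' d := congrArg γ' (by rw [he]; ring)
  have hδlen : pathELength (𝓡 m) δ b e = pathELength (𝓡 m) γ' c d := by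
    have e1 : 1 * b + (c - b) = c := by ring
    have e2 : 1 * e + (c - b) = d := by rw [he]; ring
    have := pathELength_comp_of_monotoneOn (I := 𝓡 m) (γ := γ')
      (f := fun s => 1 * s + (c - b)) (a := b) (b := e) hbe.le
      (fun s _ t _ hst => by simpa using hst)
      (((differentiable_id.const_mul (1 : ℝ)).add_const (c - b)).differentiableOn)
      (by rw [e1, e2]; exact h'.smooth.mdifferentiableOn (by simp))
    rw [e1, e2] at this
    exact this
  let η : ℝ → M := fun s => if s ≤ b then γ s else δ s
  have hηγ : EqOn η γ (Icc a b) := fun s hs => if_pos hs.2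
  have hηδ : EqOn η δ (Icc b e) := by
    intro s hs
    rcases hs.1.eq_or_lt with rfl | hlt
    · exact (if_pos le_rfl).trans hδb.symm
    · exact if_neg (not_le.2 hlt)
  have htmono : ∀ i, i ≤ n → a ≤ t i ∧ t i ≤ b := by
    intro i hi
    have hm : StrictMonoOn t (Icc 0 n) := by
      refine strictMonoOn_of_lt_succ ordConnected_Icc fun j _ hj hj' => ?_
      exact (ht j (Nat.lt_of_succ_le hj'.2)).1
    exact ⟨ht0 ▸ hm.monotoneOn ⟨le_rfl, n.zero_le⟩ ⟨i.zero_le, hi⟩ i.zero_le,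
      htn ▸ hm.monotoneOn ⟨i.zero_le, hi⟩ ⟨n.zero_le, le_rfl⟩ hi⟩
  refine ⟨η, e, ⟨hab.trans hbe, ?_, n + 1, fun i => if i ≤ n then t i else e, by simpa using ht0,
    by simp, fun i hi => ?_⟩, hηγ ⟨le_rfl, hab.le⟩, (hηδ ⟨hbe.le, le_rfl⟩).trans hδe, ?_⟩
  · rw [← Icc_union_Icc_eq_Icc hab.le hbe.le]
    exact (hcont.congr hηγ).union_of_isClosed (hδ.smooth.continuousOn.congr hηδ)
      isClosed_Icc isClosed_Icc
  · rcases Nat.lt_succ_iff_lt_or_eq.1 hi with hi | rfl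
    · have hi' : i + 1 ≤ n := hi
      simp only [hi.le, hi', if_true]
      exact ⟨(ht i hi).1, (ht i hi).2.congr
        (hηγ.mono (Icc_subset_Icc (htmono i hi.le).1 (htmono _ hi').2))⟩
    · simp only [le_refl, if_true, htn, Nat.not_succ_le_self, if_false]
      exact ⟨hbe, hδ.congr hηδ⟩
  · rw [← pathELength_add hab.le hbe.le, pathELength_congr hηγ, pathELength_congr hηδ, hδlen]

lemma Chain.exists_isBrokenGeodesicOn {ℓ : ℝ≥0∞} {p q : M} (h : S.Chain ℓ p q) :
    ∃ (γ : ℝ → M) (a b : ℝ), (S.IsBrokenGeodesicOn γ a b ∧ γ a = p ∧ γ b = q) ∧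
      pathELength (𝓡 m) γ a b = ℓ := by
  induction h with
  | @single γ a b hab hγ => exact ⟨γ, a, b, ⟨hγ.isBrokenGeodesicOn hab, rfl, rfl⟩, rfl⟩
  | @snoc ℓ p γ c d _ hab hγ ih =>
    obtain ⟨γ', a, b, ⟨hb, ha, hb'⟩, hlen⟩ := ih
    obtain ⟨η, e, h1, h2, h3, h4⟩ := hb.exists_snoc hab hγ hb'
    exact ⟨η, a, e, ⟨h1, h2.trans ha, h3⟩, by rw [h4, hlen]⟩

lemma dH_le_of_chain {ℓ : ℝ≥0∞} {p q : M} (h : S.Chain ℓ p q) : S.dH p q ≤ ℓ := by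
  obtain ⟨γ, a, b, hγ, rfl⟩ := h.exists_isBrokenGeodesicOn
  exact iInf₂_le_of_le γ a (iInf₂_le_of_le b hγ le_rfl)

lemma exists_chain_of_dH_lt {r : ℝ≥0∞} {p q : M} (h : S.dH p q < r) :
    ∃ ℓ < r, S.Chain ℓ p q := by
  simp only [dH, iInf_lt_iff] at h
  obtain ⟨γ, a, b, ⟨hγ, rfl, rfl⟩, hlt⟩ := h
  exact ⟨_, hlt, hγ.chain⟩

lemma dH_comm (S : Distribution m k M) (p q : M) : S.dH p q = S.dH q p := by
  have key : ∀ p q, S.dH p q ≤ S.dH q p := fun p q => le_of_forall_gt fun r hr => by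
    obtain ⟨ℓ, hℓ, hc⟩ := exists_chain_of_dH_lt hr
    exact (dH_le_of_chain hc.symm).trans_lt hℓ
  exact le_antisymm (key p q) (key q p)

lemma dH_triangle (S : Distribution m k M) (p q r : M) :
    S.dH p r ≤ S.dH p q + S.dH q r := by
  refine le_of_forall_gt fun s hs => ?_
  obtain ⟨s₁, h₁, s₂, h₂, hlt⟩ := ENNReal.exists_add_lt_of_add_lt hs
  obtain ⟨ℓ₁, hℓ₁, hc₁⟩ := exists_chain_of_dH_lt h₁
  obtain ⟨ℓ₂, hℓ₂, hc₂⟩ := exists_chain_of_dH_lt h₂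
  exact (dH_le_of_chain (hc₁.trans hc₂)).trans_lt ((add_le_add hℓ₁.le hℓ₂.le).trans_lt hlt)

lemma riemannianEDist_le_dH (S : Distribution m k M) (p q : M) :
    riemannianEDist (𝓡 m) p q ≤ S.dH p q := le_of_forall_gt fun r hr => by
  obtain ⟨ℓ, hℓ, hc⟩ := exists_chain_of_dH_lt hr
  exact hc.riemannianEDist_le.trans_lt hℓ

lemma dH_self [IsContMDiffRiemannianBundle (𝓡 m) ∞ (EuclideanSpace ℝ (Fin m))
      (fun x : M => TangentSpace (𝓡 m) x)] (S : Distribution m k M) (p : M) : S.dH p p = 0 :=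
  le_antisymm (dH_le_of_chain (Chain.refl S p)) zero_le

/-- `dH` dominates the Riemannian distance, and a small Riemannian ball about `p` avoids any `q ≠ p`
because points are closed. -/
lemma eq_of_dH_eq_zero [T2Space M] [IsContMDiffRiemannianBundle (𝓡 m) ∞
      (EuclideanSpace ℝ (Fin m)) (fun x : M => TangentSpace (𝓡 m) x)]
    {p q : M} (h : S.dH p q = 0) : p = q := by
  have : IsContinuousRiemannianBundle (EuclideanSpace ℝ (Fin m))
      (fun x : M => TangentSpace (𝓡 m) x) := by
    obtain ⟨g, hg, hg'⟩ := IsContMDiffRiemannianBundle.exists_contMDiff (IB := 𝓡 m) (n := ∞)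
      (F := EuclideanSpace ℝ (Fin m)) (E := fun x : M => TangentSpace (𝓡 m) x)
    exact ⟨g, hg.continuous, hg'⟩
  have : LocallyCompactSpace M := Manifold.locallyCompact_of_finiteDimensional (𝓡 m)
  by_contra hne
  obtain ⟨c, hc, hsub⟩ := setOfPred_riemannianEDist_lt_subset_nhds (𝓡 m)
    (isOpen_compl_singleton.mem_nhds hne : ({q}ᶜ : Set M) ∈ 𝓝 p)
  have h0 : riemannianEDist (𝓡 m) p q = 0 := le_antisymm (h ▸ S.riemannianEDist_le_dH p q) zero_le
  exact hsub (show riemannianEDist (𝓡 m) p q < c by rw [h0]; exact_mod_cast hc) rfl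

end Distribution

end Chains

/-! ### Local and global accessibility by chains -/

section Accessibility

variable {m : ℕ} {M : Type*} [TopologicalSpace M] [ChartedSpace (EuclideanSpace ℝ (Fin m)) M]
  [IsManifold (𝓡 m) ∞ M] {k : ℕ} {S : Distribution m k M}

namespace Distribution

lemma IsCommutator.smoothFieldOn {i : ℕ} {Z : VField m M} (h : S.IsCommutator i Z) :
    SmoothFieldOn Z univ := by
  induction h with
  | of hX => exact hX.1
  | bracket _ _ ihX ihY => exact ihX.mlieBracket isOpen_univ ihY

/-- Sections are pointwise combinations of the frame, and brackets follow by
`lieBracket_mem_range_fderiv`. Tangency is asserted on a neighbourhood, not only at `s₀`, because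
the bracket step differentiates it. -/
lemma IsCommutator.chartField_mem_range {p : M} {U : Set M} (hU : IsOpen U)
    {X : Fin k → VField m M}
    (hspan : ∀ x ∈ U, Submodule.span ℝ (range fun i => X i x) = S.at' x)
    {F : Type*} [NormedAddCommGroup F] [NormedSpace ℝ F] [FiniteDimensional ℝ F]
    {G : F → EuclideanSpace ℝ (Fin m)} {s₀ : F}
    (hGs₀ : G s₀ ∈ (extChartAt (𝓡 m) p).target ∩ (extChartAt (𝓡 m) p).symm ⁻¹' U)
    (hG : ContDiffAt ℝ 2 G s₀) (hinj : Function.Injective (fderiv ℝ G s₀))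
    (htan : ∀ᶠ s in 𝓝 s₀, ∀ i, chartField p (X i) (G s) ∈ (fderiv ℝ G s).range)
    {i : ℕ} {Z : VField m M} (h : S.IsCommutator i Z) :
    ∀ᶠ s in 𝓝 s₀, chartField p Z (G s) ∈ (fderiv ℝ G s).range := by
  have hdom : ∀ᶠ s in 𝓝 s₀,
      G s ∈ (extChartAt (𝓡 m) p).target ∩ (extChartAt (𝓡 m) p).symm ⁻¹' U :=
    hG.continuousAt.eventually ((isOpen_chartDomain p hU).mem_nhds hGs₀)
  induction h with
  | @of Z hZ =>
    filter_upwards [hdom, htan] with s hs ht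
    have hZs : Z ((extChartAt (𝓡 m) p).symm (G s))
        ∈ Submodule.span ℝ (range fun i => X i ((extChartAt (𝓡 m) p).symm (G s))) := by
      rw [hspan _ hs.2]
      exact hZ.2 _
    have hle : Submodule.span ℝ (range fun i => X i ((extChartAt (𝓡 m) p).symm (G s)))
        ≤ (fderiv ℝ G s).range.comap (chartDeriv p (G s)).inverse.toLinearMap := by
      rw [Submodule.span_le]
      rintro _ ⟨i, rfl⟩
      exact ht i
    exact hle hZs
  | @bracket i j Z Z' hZ hZ' ih ih' =>
    have hopen : ∀ᶠ s in 𝓝 s₀, Function.Injective (fderiv ℝ G s) :=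
      (hG.fderiv_right (m := 1) (by norm_num)).continuousAt.eventually
        (ContinuousLinearMap.isOpen_injective.mem_nhds hinj)
    have hdiff : ∀ {Z : VField m M}, SmoothFieldOn Z univ → ∀ {y},
        y ∈ (extChartAt (𝓡 m) p).target → DifferentiableAt ℝ (chartField p Z) y := by
      intro Z hZ y hy
      have h1 := (contDiffOn_chartField p isOpen_univ hZ).contDiffAt (x := y)
        ((isOpen_chartDomain p isOpen_univ).mem_nhds ⟨hy, mem_univ _⟩)
      exact h1.differentiableAt (by simp)
    filter_upwards [hdom, hG.eventually (by simp), hopen, eventually_eventually_nhds.2 ih,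
      eventually_eventually_nhds.2 ih'] with s hs hGs hinjs hZs hZs'
    rw [chartField_mlieBracket hs.1 hZ.smoothFieldOn hZ'.smoothFieldOn]
    exact lieBracket_mem_range_fderiv hGs hinjs (hdiff hZ.smoothFieldOn hs.1)
      (hdiff hZ'.smoothFieldOn hs.1) hZs hZs'

/-- A bracket generating distribution is not tangent to an immersion of positive codimension. -/
lemma IsBracketGenerating.noTangentImmersion (hS : S.IsBracketGenerating) {p : M} {U : Set M}
    (hU : IsOpen U) {X : Fin k → VField m M}
    (hspan : ∀ x ∈ U, Submodule.span ℝ (range fun i => X i x) = S.at' x)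
    {y : EuclideanSpace ℝ (Fin m)}
    (hy : y ∈ (extChartAt (𝓡 m) p).target ∩ (extChartAt (𝓡 m) p).symm ⁻¹' U) :
    NoTangentImmersion (fun i => chartField p (X i)) y := by
  rintro F _ _ _ G s₀ rfl hG hinj htan
  obtain ⟨l, hl⟩ := hS ((extChartAt (𝓡 m) p).symm (G s₀))
  have hle : S.derivedAt l ((extChartAt (𝓡 m) p).symm (G s₀))
      ≤ (fderiv ℝ G s₀).range.comap (chartDeriv p (G s₀)).inverse.toLinearMap := by
    refine Submodule.span_le.2 ?_
    rintro _ ⟨i, -, Z, hZ, rfl⟩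
    exact (hZ.chartField_mem_range hU hspan hy hG hinj htan).self_of_nhds
  rw [hl] at hle
  refine eq_top_iff.2 fun v _ => ?_
  have h1 : (chartDeriv p (G s₀)).inverse (chartDeriv p (G s₀) v) ∈ (fderiv ℝ G s₀).range :=
    hle trivial
  obtain ⟨e, he⟩ := chartDeriv_isInvertible hy.1
  rw [← he, ContinuousLinearMap.inverse_equiv] at h1
  change e.symm (e v) ∈ _ at h1
  rwa [e.symm_apply_apply] at h1

variable [RiemannianBundle (fun x : M => TangentSpace (𝓡 m) x)]
  [IsContMDiffRiemannianBundle (𝓡 m) ∞ (EuclideanSpace ℝ (Fin m))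
      (fun x : M => TangentSpace (𝓡 m) x)]

lemma equivalence_chain (S : Distribution m k M) :
    Equivalence fun p q => ∃ ℓ, S.Chain ℓ p q :=
  ⟨fun p => ⟨0, Chain.refl S p⟩, fun ⟨ℓ, h⟩ => ⟨ℓ, h.symm⟩,
    fun ⟨ℓ, h⟩ ⟨ℓ', h'⟩ => ⟨ℓ + ℓ', h.trans h'⟩⟩

/-- All points near `p` are joined to `p` by a broken geodesic. -/
theorem IsBracketGenerating.eventually_chain (hS : S.IsBracketGenerating) (p : M) :
    ∀ᶠ q in 𝓝 p, ∃ ℓ, S.Chain ℓ p q := by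
  obtain ⟨U, X, hX, hpU, hspan⟩ := S.exists_orthonormalFrame p
  set D := (extChartAt (𝓡 m) p).target ∩ (extChartAt (𝓡 m) p).symm ⁻¹' U with hD
  have hDo : IsOpen D := isOpen_chartDomain p hX.isOpen
  set y₀ := extChartAt (𝓡 m) p p with hy₀
  have hy₀D : y₀ ∈ D := ⟨mem_extChartAt_target p, by
    rw [mem_preimage, hy₀, extChartAt_to_inv]; exact hpU⟩
  -- The coordinates `Pi.single i 1` are those of the initial velocity `X i`.
  have hflow := fun i : Fin k => exists_local_flow (z₀ := (y₀, Pi.single i (1 : ℝ)))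
    (hDo.prod isOpen_univ) (S.contDiffOn_geodesicField p hX) ⟨hy₀D, mem_univ _⟩
  choose c N δ hNo hzN hδ hc hc1 hc' hcC using hflow
  let V : Set (EuclideanSpace ℝ (Fin m)) := D ∩ ⋂ i, (fun y => (y, Pi.single i (1 : ℝ))) ⁻¹' N i
  have hVo : IsOpen V := hDo.inter (isOpen_iInter_of_finite fun i =>
    (hNo i).preimage (Continuous.prodMk_left _))
  have hVN : ∀ y ∈ V, ∀ i, (y, Pi.single i (1 : ℝ)) ∈ N i := fun y hy i => mem_iInter.1 hy.2 i
  have h0 : ∀ i, (0 : ℝ) ∈ Ioo (-δ i) (δ i) := fun i => ⟨neg_lt_zero.2 (hδ i), hδ i⟩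
  -- The final velocity is forgotten: each new piece starts afresh with velocity `X i`, which broken
  -- geodesics allow.
  let H : Fin k → EuclideanSpace ℝ (Fin m) × ℝ → EuclideanSpace ℝ (Fin m) :=
    fun i q => (c i (q.1, Pi.single i 1) q.2 1).1
  let R : EuclideanSpace ℝ (Fin m) → EuclideanSpace ℝ (Fin m) → Prop := fun y z =>
    ∃ ℓ, S.Chain ℓ ((extChartAt (𝓡 m) p).symm y) ((extChartAt (𝓡 m) p).symm z)
  have hR : Equivalence R := (equivalence_chain S).comap _
  have hnear : ∀ᶠ y in 𝓝 y₀, R y₀ y := by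
    refine eventually_related_of_noTangentImmersion (X := fun i => chartField p (X i)) (H := H)
      hVo hR (fun y hy => hS.noTangentImmersion hX.isOpen hspan hy.1) (fun i y hy => ?_)
      (fun i y hy => ?_) (fun i y hy => ?_) (fun i y hy => ?_)
      ⟨hy₀D, mem_iInter.2 fun i => hzN i⟩
    · have h1 : ContDiffAt ℝ 2 (fun q : (EuclideanSpace ℝ (Fin m) × (Fin k → ℝ)) × ℝ =>
          c i q.1 q.2 1) ((y, Pi.single i 1), 0) :=
        (hcC i).contDiffAt (((hNo i).prod isOpen_Ioo).mem_nhds ⟨hVN y hy i, h0 i⟩)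
      have h2 : ContDiffAt ℝ 2 (fun q : EuclideanSpace ℝ (Fin m) × ℝ =>
          (((q.1, Pi.single i (1 : ℝ)) : EuclideanSpace ℝ (Fin m) × (Fin k → ℝ)), q.2)) (y, 0) :=
        (contDiffAt_fst.prodMk contDiffAt_const).prodMk contDiffAt_snd
      exact (ContDiffAt.comp (g := fun q : (EuclideanSpace ℝ (Fin m) × (Fin k → ℝ)) × ℝ =>
        c i q.1 q.2 1) (y, (0 : ℝ)) h1 h2).fst
    · exact congrArg Prod.fst (hc1 i _ (hVN y hy i))
    · have h1 : HasDerivAt (fun ε => (c i (y, Pi.single i 1) ε 1).1)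
          (S.geodesicField p X (y, Pi.single i 1)).1 0 := (hc' i _ (hVN y hy i)).fst
      have h2 : (S.geodesicField p X (y, Pi.single i 1)).1 = chartField p (X i) y := by
        rw [geodesicField, Finset.sum_eq_single i]
        · simp
        · intro j _ hj
          simp [Pi.single_eq_of_ne hj]
        · simp
      rw [h2] at h1
      exact h1
    · filter_upwards [(hVo.prod isOpen_Ioo).mem_nhds
        (show (y, (0 : ℝ)) ∈ V ×ˢ Ioo (-δ i) (δ i) from ⟨hy, h0 i⟩)] with q hq
      obtain ⟨hmem, hstart, hder⟩ := hc i _ (hVN q.1 hq.1 i) q.2 hq.2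
      have hg := S.isNonholonomicGeodesicOn_of_hasDerivWithinAt hX hmem hder
      have hch := Chain.single zero_lt_one hg
      rw [hstart] at hch
      exact ⟨_, hch⟩
  have hcont : Tendsto (extChartAt (𝓡 m) p) (𝓝 p) (𝓝 y₀) := continuousAt_extChartAt p
  filter_upwards [hcont.eventually hnear, extChartAt_source_mem_nhds (I := 𝓡 m) p] with q hq hqs
  change ∃ ℓ, S.Chain ℓ ((extChartAt (𝓡 m) p).symm y₀)
    ((extChartAt (𝓡 m) p).symm (extChartAt (𝓡 m) p q)) at hq
  rwa [(extChartAt (𝓡 m) p).left_inv hqs, hy₀, extChartAt_to_inv] at hq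

/-- Any two points of a connected manifold with a bracket generating distribution are joined by a
broken geodesic. -/
theorem IsBracketGenerating.exists_chain [PreconnectedSpace M] (hS : S.IsBracketGenerating)
    (p q : M) : ∃ ℓ, S.Chain ℓ p q := by
  have hE := equivalence_chain S
  have hopen : ∀ p, IsOpen {q | ∃ ℓ, S.Chain ℓ p q} := fun p =>
    isOpen_iff_mem_nhds.2 fun q hq => (hS.eventually_chain q).mono fun _ hr => hE.trans hq hr
  -- The complement of a class is a union of classes, all of them open.
  have hclosed : IsClosed {q | ∃ ℓ, S.Chain ℓ p q} := by
    refine isOpen_compl_iff.1 (isOpen_iff_mem_nhds.2 fun q hq => ?_)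
    filter_upwards [(hopen q).mem_nhds (hE.refl q)] with r hr hpr
    exact hq (hE.trans hpr (hE.symm hr))
  have huniv := IsClopen.eq_univ ⟨hclosed, hopen p⟩ ⟨p, hE.refl p⟩
  have hq : q ∈ {q | ∃ ℓ, S.Chain ℓ p q} := by
    rw [huniv]
    exact mem_univ q
  exact hq

end Distribution

end Accessibility
end SubRiem
end

theorem mainTheorem5 {m k : ℕ} {M : Type*} [TopologicalSpace M] [T2Space M] [ConnectedSpace M]
    [ChartedSpace (EuclideanSpace ℝ (Fin m)) M] [IsManifold (𝓡 m) ∞ M]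
    [RiemannianBundle (fun x : M => TangentSpace (𝓡 m) x)]
    [IsContMDiffRiemannianBundle (𝓡 m) ∞ (EuclideanSpace ℝ (Fin m))
      (fun x : M => TangentSpace (𝓡 m) x)]
    (S : SubRiem.Distribution m k M) (hS : S.IsBracketGenerating) :
    (∀ p q : M, ∃ (γ : ℝ → M) (a b : ℝ), S.IsBrokenGeodesicOn γ a b ∧ γ a = p ∧ γ b = q) ∧
    (∀ p q : M, S.dH p q ≠ ⊤) ∧
    (∀ p q : M, S.dH p q = 0 ↔ p = q) ∧
    (∀ p q : M, S.dH p q = S.dH q p) ∧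
    (∀ p q r : M, S.dH p r ≤ S.dH p q + S.dH q r) := by
  refine ⟨fun p q => ?_, fun p q => ?_, fun p q => ⟨SubRiem.Distribution.eq_of_dH_eq_zero, ?_⟩,
    S.dH_comm, S.dH_triangle⟩
  · obtain ⟨ℓ, h⟩ := hS.exists_chain p q
    obtain ⟨γ, a, b, hγ, -⟩ := h.exists_isBrokenGeodesicOn
    exact ⟨γ, a, b, hγ⟩
  · obtain ⟨ℓ, h⟩ := hS.exists_chain p q
    exact ne_top_of_le_ne_top h.ne_top (SubRiem.Distribution.dH_le_of_chain h)
  · rintro rfl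
    exact S.dH_self p
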